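/- For a natural number $d$ let $S_d$ be the symmetric group on $d$ letters, and let the norm $N(\sigma)$ of $\sigma\in S_d$ be the least number of transpositions whose product is $\sigma$. Let $F_n\mathbb{Q}[S_d]$ be the span of the permutations of norm at most $n$, let $Z(d)$ be the class-sum algebra of $\mathbb{Q}[S_d]$ (the centre of $\mathbb{Q}[S_d]$, spanned by the sums of the conjugacy classes), filtered by $F_nZ(d)=Z(d)\cap F_n\mathbb{Q}[S_d]$, with $F_{-1}Z(d)=0$, and let $$A(d)=\bigoplus_{n\ge 0}F_nZ(d)/F_{n-1}Z(d)$$ be the associated graded commutative $\mathbb{Q}$-algebra. For $k\ge 2$ let $\gamma_k(d)\in A(d)$ be the homogeneous element of degree $k-1$ represented by the sum of all $k$-cycles in $S_d$. Let $m=\lfloor d/2\rfloor$. Then $\gamma_2(d),\dots,\gamma_{m+1}(d)$ form a minimal set of generators of $A(d)$: they generate $A(d)$ as a $\mathbb{Q}$-algebra, and for no proper subset $s\subsetneq\{2,\dots,m+1\}$ do the elements $\gamma_k(d)$, $k\in s$, generate $A(d)$. -/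

import Mathlib

open scoped DirectSum

noncomputable section

/-! ### Filtered algebras and their associated graded algebras -/

/-- An increasing multiplicative filtration `F 0 ≤ F 1 ≤ ...` of a commutative `K`-algebra `A`
by `K`-submodules. -/
structure AlgFiltration (K A : Type*) [CommRing K] [CommRing A] [Algebra K A] where
  /-- The `n`-th filtration step. -/
  step : ℕ → Submodule K A
  mono : Monotone step
  one_mem : (1 : A) ∈ step 0
  mul_mem : ∀ {i j : ℕ} {x y : A}, x ∈ step i → y ∈ step j → x * y ∈ step (i + j)

namespace AlgFiltration

variable {K A : Type*} [CommRing K] [CommRing A] [Algebra K A] (F : AlgFiltration K A)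

/-- The part of the filtration strictly below `n`: it is `⊥` for `n = 0` and `F (n - 1)` for
`n ≥ 1`. -/
def lower (n : ℕ) : Submodule K A := ⨆ m : ℕ, ⨆ _ : m < n, F.step m

theorem lower_zero : F.lower 0 = ⊥ := by simp [lower]

theorem lower_succ (n : ℕ) : F.lower (n + 1) = F.step n :=
  le_antisymm (iSup₂_le fun _ h => F.mono (Nat.lt_succ_iff.mp h))
    (le_iSup₂_of_le n (Nat.lt_succ_self n) le_rfl)

theorem mul_mem_lower_left {i j : ℕ} {x y : A} (hx : x ∈ F.lower i) (hy : y ∈ F.step j) :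
    x * y ∈ F.lower (i + j) := by
  cases i with
  | zero =>
    rw [lower_zero, Submodule.mem_bot] at hx
    simp [hx]
  | succ i =>
    rw [lower_succ] at hx
    rw [Nat.add_right_comm, lower_succ]
    exact F.mul_mem hx hy

theorem mul_mem_lower_right {i j : ℕ} {x y : A} (hx : x ∈ F.step i) (hy : y ∈ F.lower j) :
    x * y ∈ F.lower (i + j) := by
  rw [mul_comm, add_comm]
  exact F.mul_mem_lower_left hy hx

/-- The `n`-th graded piece `F n / F (n - 1)` (with `F (-1) = 0`). -/
def Piece (n : ℕ) : Type _ := ↥(F.step n) ⧸ (F.lower n).comap (F.step n).subtype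

instance (n : ℕ) : AddCommGroup (F.Piece n) :=
  inferInstanceAs (AddCommGroup (↥(F.step n) ⧸ (F.lower n).comap (F.step n).subtype))

instance (n : ℕ) : Module K (F.Piece n) :=
  inferInstanceAs (Module K (↥(F.step n) ⧸ (F.lower n).comap (F.step n).subtype))

/-- The class in `F n / F (n - 1)` of an element of `F n`. -/
def toPiece (n : ℕ) : ↥(F.step n) →ₗ[K] F.Piece n := Submodule.mkQ _

theorem toPiece_surjective (n : ℕ) : Function.Surjective (F.toPiece n) :=
  Submodule.mkQ_surjective _

theorem toPiece_eq_zero_iff {n : ℕ} (x : F.step n) :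
    F.toPiece n x = 0 ↔ (x : A) ∈ F.lower n :=
  Submodule.Quotient.mk_eq_zero _

/-- The multiplication `F i × F j → F (i + j)`. -/
def stepMul (i j : ℕ) : ↥(F.step i) →ₗ[K] ↥(F.step j) →ₗ[K] ↥(F.step (i + j)) :=
  LinearMap.mk₂ K (fun x y => ⟨(x : A) * (y : A), F.mul_mem x.2 y.2⟩)
    (fun _ _ _ => Subtype.ext (add_mul _ _ _))
    (fun _ _ _ => Subtype.ext (smul_mul_assoc _ _ _))
    (fun _ _ _ => Subtype.ext (mul_add _ _ _))
    (fun _ _ _ => Subtype.ext (mul_smul_comm _ _ _))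

/-- The multiplication induced on the graded pieces: `[x] * [y] = [x * y]`. -/
def pieceMul (i j : ℕ) : F.Piece i →ₗ[K] F.Piece j →ₗ[K] F.Piece (i + j) :=
  Submodule.liftQ _
    { toFun := fun x => Submodule.liftQ _ ((F.toPiece (i + j)).comp (F.stepMul i j x)) (by
        intro y hy
        rw [LinearMap.mem_ker, LinearMap.comp_apply, toPiece_eq_zero_iff]
        exact F.mul_mem_lower_right x.2 hy)
      map_add' := fun x x' => by
        apply Submodule.linearMap_qext
        ext1 y
        change F.toPiece (i + j) (F.stepMul i j (x + x') y)
          = F.toPiece (i + j) (F.stepMul i j x y) + F.toPiece (i + j) (F.stepMul i j x' y)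
        simp
      map_smul' := fun r x => by
        apply Submodule.linearMap_qext
        ext1 y
        change F.toPiece (i + j) (F.stepMul i j (r • x) y)
          = r • F.toPiece (i + j) (F.stepMul i j x y)
        simp }
    (by
      intro x hx
      rw [LinearMap.mem_ker]
      apply Submodule.linearMap_qext
      ext1 y
      change F.toPiece (i + j) (F.stepMul i j x y) = 0
      rw [toPiece_eq_zero_iff]
      exact F.mul_mem_lower_left hx y.2)

theorem pieceMul_toPiece {i j : ℕ} (x : F.step i) (y : F.step j) :
    F.pieceMul i j (F.toPiece i x) (F.toPiece j y)
      = F.toPiece (i + j) ⟨(x : A) * (y : A), F.mul_mem x.2 y.2⟩ := rfl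

theorem mk_toPiece_congr {i j : ℕ} (h : i = j) {x : F.step i} {y : F.step j}
    (hxy : (x : A) = y) :
    GradedMonoid.mk (A := F.Piece) i (F.toPiece i x) = GradedMonoid.mk j (F.toPiece j y) := by
  subst h
  rw [Subtype.ext hxy]

theorem gradedMonoid_cases {p : GradedMonoid F.Piece → Prop}
    (h : ∀ (n : ℕ) (x : F.step n), p (GradedMonoid.mk n (F.toPiece n x)))
    (a : GradedMonoid F.Piece) : p a := by
  obtain ⟨n, q⟩ := a
  obtain ⟨x, rfl⟩ := F.toPiece_surjective n q
  exact h n x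

instance : GradedMonoid.GMul F.Piece where
  mul {i j} a b := F.pieceMul i j a b

instance : GradedMonoid.GOne F.Piece where
  one := F.toPiece 0 ⟨1, F.one_mem⟩

theorem mk_mul_mk {i j : ℕ} (x : F.step i) (y : F.step j) :
    GradedMonoid.mk (A := F.Piece) i (F.toPiece i x) * GradedMonoid.mk j (F.toPiece j y)
      = GradedMonoid.mk (i + j) (F.toPiece (i + j) ⟨(x : A) * (y : A), F.mul_mem x.2 y.2⟩) :=
  rfl

instance instGCommRingPiece : DirectSum.GCommRing F.Piece where
  mul_zero a := map_zero (F.pieceMul _ _ a)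
  zero_mul b := by
    change F.pieceMul _ _ 0 b = 0
    simp
  mul_add a b c := map_add (F.pieceMul _ _ a) b c
  add_mul a b c := by
    change F.pieceMul _ _ (a + b) c = F.pieceMul _ _ a c + F.pieceMul _ _ b c
    simp
  one_mul := F.gradedMonoid_cases fun n x =>
    F.mk_toPiece_congr (zero_add n) (one_mul (x : A))
  mul_one := F.gradedMonoid_cases fun n x =>
    F.mk_toPiece_congr (add_zero n) (mul_one (x : A))
  mul_assoc a b c := by
    induction a using F.gradedMonoid_cases with | h i x
    induction b using F.gradedMonoid_cases with | h j y
    induction c using F.gradedMonoid_cases with | h k z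
    exact F.mk_toPiece_congr (add_assoc i j k) (mul_assoc (x : A) y z)
  mul_comm a b := by
    induction a using F.gradedMonoid_cases with | h i x
    induction b using F.gradedMonoid_cases with | h j y
    exact F.mk_toPiece_congr (add_comm i j) (mul_comm (x : A) y)
  natCast n := n • F.toPiece 0 ⟨1, F.one_mem⟩
  natCast_zero := zero_smul _ _
  natCast_succ n := succ_nsmul _ n
  intCast n := n • F.toPiece 0 ⟨1, F.one_mem⟩
  intCast_ofNat n := natCast_zsmul _ n
  intCast_negSucc_ofNat n := negSucc_zsmul _ n

instance : DirectSum.GAlgebra K F.Piece where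
  toFun := (LinearMap.toSpanSingleton K (F.Piece 0) (F.toPiece 0 ⟨1, F.one_mem⟩)).toAddMonoidHom
  map_one := one_smul K (F.toPiece 0 ⟨1, F.one_mem⟩)
  map_mul r s := F.mk_toPiece_congr (x := (r * s) • ⟨1, F.one_mem⟩) (j := 0 + 0)
    (y := ⟨(r • (1 : A)) * (s • (1 : A)), F.mul_mem (Submodule.smul_mem _ r F.one_mem)
      (Submodule.smul_mem _ s F.one_mem)⟩) rfl
    (by simp [mul_smul, smul_comm r s])
  commutes r := F.gradedMonoid_cases fun n x => by
    refine F.mk_toPiece_congr (i := 0 + n) (j := n + 0)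
      (x := ⟨(r • (1 : A)) * x, F.mul_mem (Submodule.smul_mem _ r F.one_mem) x.2⟩)
      (y := ⟨(x : A) * (r • (1 : A)), F.mul_mem x.2 (Submodule.smul_mem _ r F.one_mem)⟩)
      (by simp) (mul_comm _ _)
  smul_def r := F.gradedMonoid_cases fun n x => by
    refine F.mk_toPiece_congr (i := n) (j := 0 + n) (x := r • x)
      (y := ⟨(r • (1 : A)) * x, F.mul_mem (Submodule.smul_mem _ r F.one_mem) x.2⟩)
      (by simp) (by simp)

/-- The associated graded algebra `⨁ n, F n / F (n - 1)`; it is a commutative `K`-algebra. -/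
abbrev Gr : Type _ := ⨁ n, F.Piece n

/-- The homogeneous element of degree `n` of the associated graded algebra represented by an
element of `F n`. -/
def symbol (n : ℕ) (x : F.step n) : F.Gr := DirectSum.of F.Piece n (F.toPiece n x)

theorem symbol_mul_symbol {i j : ℕ} (x : F.step i) (y : F.step j) :
    F.symbol i x * F.symbol j y = F.symbol (i + j) ⟨(x : A) * (y : A), F.mul_mem x.2 y.2⟩ :=
  DirectSum.of_mul_of _ _

end AlgFiltration

/-! ### The norm on the symmetric group -/

open Equiv

/-- The norm of a permutation: the least number of transpositions whose product it is. -/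
def permNorm {d : ℕ} (σ : Perm (Fin d)) : ℕ :=
  sInf {n : ℕ | ∃ l : List (Perm (Fin d)), (∀ τ ∈ l, τ.IsSwap) ∧ l.prod = σ ∧ l.length = n}

theorem permNorm_le_of_list {d : ℕ} (l : List (Perm (Fin d))) (hl : ∀ τ ∈ l, τ.IsSwap) :
    permNorm l.prod ≤ l.length :=
  Nat.sInf_le ⟨l, hl, rfl, rfl⟩

theorem exists_list_length_eq_permNorm {d : ℕ} (σ : Perm (Fin d)) :
    ∃ l : List (Perm (Fin d)), (∀ τ ∈ l, τ.IsSwap) ∧ l.prod = σ ∧ l.length = permNorm σ := by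
  refine Nat.sInf_mem
    (s := {n : ℕ | ∃ l : List (Perm (Fin d)), (∀ τ ∈ l, τ.IsSwap) ∧ l.prod = σ ∧ l.length = n}) ?_
  exact ⟨_, (Perm.swapFactors σ).1, (Perm.swapFactors σ).2.2, (Perm.swapFactors σ).2.1, rfl⟩

theorem permNorm_one {d : ℕ} : permNorm (1 : Perm (Fin d)) = 0 :=
  Nat.le_zero.mp (permNorm_le_of_list [] (by simp))

theorem permNorm_mul_le {d : ℕ} (σ τ : Perm (Fin d)) :
    permNorm (σ * τ) ≤ permNorm σ + permNorm τ := by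
  obtain ⟨l, hl, hσ, hn⟩ := exists_list_length_eq_permNorm σ
  obtain ⟨l', hl', hτ, hn'⟩ := exists_list_length_eq_permNorm τ
  have h := permNorm_le_of_list (l ++ l') (fun ρ hρ =>
    (List.mem_append.mp hρ).elim (hl ρ) (hl' ρ))
  rwa [List.prod_append, List.length_append, hσ, hτ, hn, hn'] at h

theorem permNorm_formPerm_le {d : ℕ} (l : List (Fin d)) (hl : l.Nodup) :
    permNorm l.formPerm ≤ l.length - 1 := by
  induction l with
  | nil => simp [permNorm_one]
  | cons x l ih =>
    cases l with
    | nil => simp [permNorm_one]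
    | cons y l =>
      have hxy : x ≠ y := by
        rintro rfl
        simp at hl
      have h1 : permNorm (swap x y) ≤ 1 := by
        simpa using permNorm_le_of_list [swap x y] (by simpa using ⟨x, y, hxy, rfl⟩)
      have h2 := ih (List.nodup_cons.mp hl).2
      have h3 := permNorm_mul_le (swap x y) (List.formPerm (y :: l))
      rw [List.formPerm_cons_cons]
      simp only [List.length_cons] at h2 ⊢
      omega

/-- A `k`-cycle has norm at most `k - 1`. -/
theorem permNorm_le_of_isCycle {d : ℕ} {σ : Perm (Fin d)} (hσ : σ.IsCycle) :
    permNorm σ ≤ σ.support.card - 1 := by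
  obtain ⟨x, hx, -⟩ := id hσ
  have h := permNorm_formPerm_le (Perm.toList σ x) (Perm.nodup_toList σ x)
  rwa [Perm.formPerm_toList, Perm.length_toList, hσ.cycleOf_eq hx] at h

/-! ### The class-sum algebra, its norm filtration and the algebra `A(d)` -/

/-- The class-sum algebra of `ℚ[S_d]`, i.e. the centre of the group algebra, which is spanned by
the sums of the conjugacy classes. -/
abbrev ClassAlg (d : ℕ) : Type := ↥(Subalgebra.center ℚ (MonoidAlgebra ℚ (Perm (Fin d))))

/-- The norm filtration of the group algebra: the `n`-th step is spanned by the permutations of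
norm at most `n`. -/
def normStep (d n : ℕ) : Submodule ℚ (MonoidAlgebra ℚ (Perm (Fin d))) :=
  Submodule.span ℚ ((fun σ => MonoidAlgebra.single σ (1 : ℚ)) '' {σ | permNorm σ ≤ n})

theorem single_mem_normStep {d n : ℕ} {σ : Perm (Fin d)} (h : permNorm σ ≤ n) :
    MonoidAlgebra.single σ (1 : ℚ) ∈ normStep d n :=
  Submodule.subset_span ⟨σ, h, rfl⟩

theorem mul_mem_normStep {d i j : ℕ} {x y : MonoidAlgebra ℚ (Perm (Fin d))}
    (hx : x ∈ normStep d i) (hy : y ∈ normStep d j) : x * y ∈ normStep d (i + j) := by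
  have h := Submodule.mul_mem_mul hx hy
  rw [normStep, normStep, Submodule.span_mul_span] at h
  refine Submodule.span_le.mpr ?_ h
  rintro _ ⟨_, ⟨σ, hσ, rfl⟩, _, ⟨τ, hτ, rfl⟩, rfl⟩
  simp only [MonoidAlgebra.single_mul_single, mul_one, SetLike.mem_coe]
  exact single_mem_normStep ((permNorm_mul_le σ τ).trans (Nat.add_le_add hσ hτ))

/-- The norm filtration of the class-sum algebra, induced from the one of the group algebra. -/
def normFiltration (d : ℕ) : AlgFiltration ℚ (ClassAlg d) where
  step n := (normStep d n).comap
    (Subalgebra.center ℚ (MonoidAlgebra ℚ (Perm (Fin d)))).val.toLinearMap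
  mono _ _ h := Submodule.comap_mono
    (Submodule.span_mono (Set.image_mono fun _ hσ => le_trans hσ h))
  one_mem := single_mem_normStep (le_of_eq permNorm_one)
  mul_mem hx hy := mul_mem_normStep hx hy

/-- The graded commutative `ℚ`-algebra `A(d)`. -/
abbrev GradedClassAlg (d : ℕ) : Type := (normFiltration d).Gr

/-- The sum in `ℚ[S_d]` of all `k`-cycles, `k ≥ 2` (it is zero for `k > d`). -/
def cycleSum (d k : ℕ) : MonoidAlgebra ℚ (Perm (Fin d)) :=
  ∑ σ : Perm (Fin d) with σ.cycleType = {k}, MonoidAlgebra.single σ (1 : ℚ)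

theorem cycleSum_mem_center (d k : ℕ) :
    cycleSum d k ∈ Subalgebra.center ℚ (MonoidAlgebra ℚ (Perm (Fin d))) := by
  rw [Subalgebra.mem_center_iff]
  intro b
  induction b using MonoidAlgebra.induction_linear with
  | zero => simp
  | add x y hx hy => rw [add_mul, mul_add, hx, hy]
  | single τ r =>
    simp only [cycleSum, Finset.mul_sum, Finset.sum_mul, MonoidAlgebra.single_mul_single, mul_one,
      one_mul]
    refine Finset.sum_equiv (MulAut.conj τ).toEquiv (fun σ => ?_) (fun σ _ => ?_)
    · simp [MulAut.conj_apply, Perm.cycleType_conj]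
    · simp [MulAut.conj_apply, mul_assoc]

theorem cycleSum_mem_normStep (d k : ℕ) : cycleSum d k ∈ normStep d (k - 1) := by
  refine Submodule.sum_mem _ fun σ hσ => single_mem_normStep ?_
  have h := (Finset.mem_filter.mp hσ).2
  have h1 : σ.IsCycle := Perm.card_cycleType_eq_one.mp (by rw [h, Multiset.card_singleton])
  have h2 : σ.support.card = k := by rw [← Perm.sum_cycleType, h, Multiset.sum_singleton]
  exact h2 ▸ permNorm_le_of_isCycle h1

/-- The element `γ_k(d)` of `A(d)`, of degree `k - 1`, represented by the sum of all `k`-cycles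
in `S_d`; it is meant for `k ≥ 2`. -/
def gammaElt (d k : ℕ) : GradedClassAlg d :=
  (normFiltration d).symbol (k - 1) ⟨⟨cycleSum d k, cycleSum_mem_center d k⟩,
    cycleSum_mem_normStep d k⟩

end

/-!
Let `R` be the graded group algebra of `S_d`: it has the permutations as a basis, and the product
of `σ` and `τ` is `σ * τ` if the norms of `σ` and `τ` add up to the norm of `σ * τ`, and zero
otherwise. Taking parts of top norm embeds `A(d)` into `R` as the algebra of class functions, and
`γ_k` becomes the sum of the `k`-cycles. Here `R` acts faithfully on itself by left multiplication,
so that it is realized by operators (`gradedRep`, `grRep`, `grRep_injective`). The norm of a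
permutation is the number of its moved points minus the number of its nontrivial cycles
(`permNorm_add_card_cycleType`).

Generation rests on two facts. First, if the norms of `σ` and `τ` add up, then `σ * τ` has fewer
nontrivial cycles than `σ` and `τ` together unless they are disjoint. Hence multiplying a class sum
by `γ_k` gives a nonzero multiple of the class in which a disjoint `k`-cycle is added, plus classes
with fewer cycles, and all class sums are polynomials in the `γ_k`. Second, the `γ_k` of degree
`n > d / 2` are decomposable, because there is no product of `n` disjoint transpositions in `S_d`.
To see this, let `M` be the sum of all involutions in `R` (with the identity), and let `J_i` be the
sum of all transpositions that move `i`. If `M_i` is the sum of the involutions that fix `i`, then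
`M = M_i * (1 + u(J_i))`, where `u = X * c` and `c = ∑ (-1) ^ k * catalan k * X ^ k` satisfies
`c + X * c ^ 2 = 1` (`involSumThrough_eq`). So `M - M_i = M * (1 - c(J_i))`. The powers of `J_i` are
sums of cycles through `i`, and summation over `i` gives in degree `n`
`2 * n * M_n = ∑ (-1) ^ (k - 1) * (k + 1) * catalan k * M_(n - k) * γ_(k + 1)`, the sum being over
`1 ≤ k ≤ n`, where `M_n` is the sum of the products of `n` disjoint transpositions
(`sum_card_support_smul_invol_permNorm`). For `2 * n > d` the left side vanishes, and the term
`k = n` is a nonzero multiple of `γ_(n + 1)`.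

Minimality is a count of dimensions: for `2 * n ≤ d` the degree `n` part of `A(d)` has a basis
indexed by the partitions of `n`, and the monomials of degree `n` in the `γ_j` with `j ≠ n + 1` are
indexed by partitions of `n` with more than one part (`adjoin_gammaElt_ne_top`).
-/

noncomputable section
open Equiv

/-! ### The norm and the cycle type -/

theorem apply_list_prod_eq {α β : Type*} {f : α → β} {l : List (Perm α)}
    (h : ∀ τ ∈ l, ∀ x, f (τ x) = f x) (x : α) : f (l.prod x) = f x := by
  induction l with
  | nil => simp
  | cons τ l ih =>
    rw [List.prod_cons, Perm.mul_apply, h τ (by simp), ih fun ρ hρ => h ρ (by simp [hρ])]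

/-- Functions constant on the cycles of a permutation form a space of dimension at most the number
of its cycles, fixed points included, and each transposition of `l` imposes only one linear
condition on a function. -/
theorem card_support_le_card_cycleType_add_length {d : ℕ} (l : List (Perm (Fin d)))
    (hl : ∀ τ ∈ l, τ.IsSwap) :
    l.prod.support.card ≤ l.prod.cycleType.card + l.length := by
  have hsw : ∀ j : Fin l.length, ∃ x y : Fin d, l[j] = swap x y := fun j => by
    obtain ⟨x, y, -, h⟩ := hl l[j] (List.getElem_mem _)
    exact ⟨x, y, h⟩
  choose a b hab using hsw
  let φ : (Fin d → ℚ) →ₗ[ℚ] (Fin l.length → ℚ) :=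
    LinearMap.pi fun j =>
      LinearMap.proj (R := ℚ) (φ := fun _ : Fin d => ℚ) (a j) - LinearMap.proj (b j)
  -- A function in the kernel is invariant under every transposition of `l`, hence under their
  -- product.
  have hinv : ∀ f ∈ LinearMap.ker φ, ∀ x, f (l.prod x) = f x := by
    intro f hf
    have h1 : ∀ τ ∈ l, ∀ x, f (τ x) = f x := by
      intro τ hτ x
      obtain ⟨j, hj, rfl⟩ := List.getElem_of_mem hτ
      have h2 : f (a ⟨j, hj⟩) - f (b ⟨j, hj⟩) = 0 := congrFun (LinearMap.mem_ker.mp hf) ⟨j, hj⟩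
      have h3 : l[j] = swap (a ⟨j, hj⟩) (b ⟨j, hj⟩) := hab ⟨j, hj⟩
      rw [h3, swap_apply_def]
      split_ifs with h4 h5
      · rw [h4]; linarith
      · rw [h5]; linarith
      · rfl
    exact apply_list_prod_eq h1
  set σ := l.prod with hσ
  have hpt : ∀ c : σ.cycleFactorsFinset, ∃ x, (c : Perm (Fin d)) x ≠ x := fun c =>
    let ⟨x, hx, _⟩ := (Perm.mem_cycleFactorsFinset_iff.mp c.2).1
    ⟨x, hx⟩
  choose p hp using hpt
  -- An invariant function is determined by its values at one point of each cycle and at the fixed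
  -- points.
  let q : (σ.cycleFactorsFinset ⊕ (σ.supportᶜ : Finset (Fin d))) → Fin d := Sum.elim p Subtype.val
  let ψ : LinearMap.ker φ →ₗ[ℚ] ((σ.cycleFactorsFinset ⊕ (σ.supportᶜ : Finset (Fin d))) → ℚ) :=
    (LinearMap.pi fun s => LinearMap.proj (q s)) ∘ₗ
      (LinearMap.ker φ).subtype
  have hψ : Function.Injective ψ := by
    rw [← LinearMap.ker_eq_bot, LinearMap.ker_eq_bot']
    rintro ⟨f, hf⟩ h0
    have h1 : ∀ s, f (q s) = 0 := fun s => congrFun h0 s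
    ext x
    change f x = 0
    by_cases hx : x ∈ σ.support
    · have hc := Perm.cycleOf_mem_cycleFactorsFinset_iff.mpr hx
      have h2 : f (p ⟨_, hc⟩) = 0 := h1 (Sum.inl ⟨_, hc⟩)
      have h3 : Perm.SameCycle σ x (p ⟨_, hc⟩) := by
        have h4 := hp ⟨_, hc⟩
        by_contra h5
        exact h4 (Perm.cycleOf_apply_of_not_sameCycle h5)
      obtain ⟨i, hi⟩ := h3.exists_pow_eq''
      obtain ⟨-, -, hi⟩ := hi
      rw [← hi] at h2
      have h6 : ∀ i : ℕ, f ((σ ^ i) x) = f x := by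
        intro i
        induction i with
        | zero => simp
        | succ i ih => rw [pow_succ', Perm.mul_apply, hinv f hf, ih]
      rw [← h6 i, h2]
    · exact h1 (Sum.inr ⟨x, by simpa using hx⟩)
  have h1 := LinearMap.finrank_le_finrank_of_injective hψ
  have h2 := φ.finrank_range_add_finrank_ker
  have h3 := Submodule.finrank_le (LinearMap.range φ)
  have h4 : σ.support.card ≤ d := σ.support.card_le_univ.trans_eq (Fintype.card_fin d)
  have h5 : σ.cycleType.card = σ.cycleFactorsFinset.card := by simp [Perm.cycleType_def]
  simp only [Module.finrank_fintype_fun_eq_card, Fintype.card_fin, Fintype.card_sum,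
    Fintype.card_coe, Finset.card_compl] at h1 h2 h3
  omega

/-- The norm of a permutation is the number of moved points minus the number of nontrivial
cycles. -/
theorem permNorm_add_card_cycleType {d : ℕ} (σ : Perm (Fin d)) :
    permNorm σ + σ.cycleType.card = σ.support.card := by
  refine le_antisymm ?_ ?_
  · induction σ using Perm.cycle_induction_on with
    | base_one => simp [permNorm_one]
    | base_cycles σ hσ =>
      have h1 := permNorm_le_of_isCycle hσ
      have h2 := hσ.two_le_card_support
      rw [hσ.cycleType, Multiset.card_singleton]
      omega
    | induction_disjoint σ τ hd hc hσ hτ =>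
      have h := permNorm_mul_le σ τ
      rw [hd.cycleType_mul, Multiset.card_add, hd.card_support_mul]
      omega
  · obtain ⟨l, hl, rfl, hn⟩ := exists_list_length_eq_permNorm σ
    have := card_support_le_card_cycleType_add_length l hl
    omega

theorem permNorm_eq_of_cycleType_eq {d : ℕ} {σ τ : Perm (Fin d)}
    (h : σ.cycleType = τ.cycleType) : permNorm σ = permNorm τ := by
  have h1 := permNorm_add_card_cycleType σ
  have h2 := permNorm_add_card_cycleType τ
  rw [← Perm.sum_cycleType] at h1 h2
  rw [h] at h1
  omega

theorem permNorm_eq_zero_iff {d : ℕ} {σ : Perm (Fin d)} : permNorm σ = 0 ↔ σ = 1 := by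
  refine ⟨fun h => ?_, fun h => h ▸ permNorm_one⟩
  obtain ⟨l, -, rfl, hn⟩ := exists_list_length_eq_permNorm σ
  rw [h, List.length_eq_zero_iff] at hn
  simp [hn]

theorem permNorm_conj {d : ℕ} (σ τ : Perm (Fin d)) : permNorm (τ * σ * τ⁻¹) = permNorm σ :=
  permNorm_eq_of_cycleType_eq Perm.cycleType_conj

theorem permNorm_mul_of_disjoint {d : ℕ} {σ τ : Perm (Fin d)} (h : σ.Disjoint τ) :
    permNorm (σ * τ) = permNorm σ + permNorm τ := by
  have h1 := permNorm_add_card_cycleType σ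
  have h2 := permNorm_add_card_cycleType τ
  have h3 := permNorm_add_card_cycleType (σ * τ)
  rw [h.cycleType_mul, Multiset.card_add, h.card_support_mul] at h3
  omega

theorem permNorm_of_isCycle {d : ℕ} {σ : Perm (Fin d)} (h : σ.IsCycle) :
    permNorm σ + 1 = σ.support.card := by
  rw [← permNorm_add_card_cycleType, h.cycleType, Multiset.card_singleton]

theorem permNorm_swap {d : ℕ} {a b : Fin d} (h : a ≠ b) : permNorm (swap a b) = 1 := by
  have := permNorm_of_isCycle (Perm.isCycle_swap h)
  rw [Perm.card_support_swap h] at this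
  omega

/-- In a product of permutations whose norms add up, the number of nontrivial cycles does not grow,
and it is additive only for disjoint factors. -/
theorem card_cycleType_mul_lt_or_disjoint {d : ℕ} {σ τ : Perm (Fin d)}
    (h : permNorm (σ * τ) = permNorm σ + permNorm τ) :
    (σ * τ).cycleType.card < σ.cycleType.card + τ.cycleType.card ∨ σ.Disjoint τ := by
  have h1 := permNorm_add_card_cycleType σ
  have h2 := permNorm_add_card_cycleType τ
  have h3 := permNorm_add_card_cycleType (σ * τ)
  have h4 := Finset.card_le_card (Perm.support_mul_le σ τ)
  have h5 := Finset.card_union_add_card_inter σ.support τ.support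
  rw [Finset.sup_eq_union] at h4
  by_cases h6 : (σ.support ∩ τ.support).card = 0
  · right
    rw [Perm.disjoint_iff_disjoint_support, Finset.disjoint_iff_inter_eq_empty]
    exact Finset.card_eq_zero.mp h6
  · left
    omega
end

noncomputable section
open Equiv

/-! ### Jucys–Murphy elements of the graded group algebra -/

/-- `T` turns permutations into elements of a ring, with the multiplication rule of the graded
group algebra: `T σ * T τ` is `T (σ * τ)` if the norms add up and zero otherwise. -/
structure IsGradedRep {d : ℕ} {E : Type*} [Ring E] (T : Perm (Fin d) → E) : Prop where
  map_one : T 1 = 1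
  map_mul : ∀ {σ τ}, permNorm (σ * τ) = permNorm σ + permNorm τ → T σ * T τ = T (σ * τ)
  map_mul_zero : ∀ {σ τ}, permNorm (σ * τ) ≠ permNorm σ + permNorm τ → T σ * T τ = 0

variable {d : ℕ} {E : Type*} [Ring E] {T : Perm (Fin d) → E}

/-- The Jucys–Murphy element of `i` over the set `S`: the sum of the transpositions `(a i)`,
`a ∈ S`. -/
def jucysMurphy (T : Perm (Fin d) → E) (i : Fin d) (S : Finset (Fin d)) : E :=
  ∑ a ∈ S, T (swap a i)

/-- The cycles of length `k + 1` through `i` whose other points lie in `S`; for `k = 0` this is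
the identity only. -/
def cyclesThrough (i : Fin d) (S : Finset (Fin d)) (k : ℕ) : Finset (Perm (Fin d)) :=
  {π | permNorm π = k ∧ (insert i π.support).card = k + 1 ∧ π.support ⊆ insert i S}

theorem mem_cyclesThrough {i : Fin d} {S : Finset (Fin d)} {k : ℕ} {π : Perm (Fin d)} :
    π ∈ cyclesThrough i S k ↔
      permNorm π = k ∧ (insert i π.support).card = k + 1 ∧ π.support ⊆ insert i S := by
  simp [cyclesThrough]

theorem permNorm_lt_card_support {π : Perm (Fin d)} (h : π ≠ 1) :
    permNorm π < π.support.card := by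
  have h1 := permNorm_add_card_cycleType π
  have h2 := Perm.card_cycleType_pos.mpr h
  omega

theorem cycleType_of_mem_cyclesThrough {i : Fin d} {S : Finset (Fin d)} {k : ℕ}
    {π : Perm (Fin d)} (h : π ∈ cyclesThrough i S k) (hπ : π ≠ 1) :
    i ∈ π.support ∧ π.cycleType = {k + 1} := by
  obtain ⟨h1, h2, -⟩ := mem_cyclesThrough.mp h
  have h3 := permNorm_add_card_cycleType π
  have h4 := permNorm_lt_card_support hπ
  have h5 : i ∈ π.support := by
    by_contra h5
    rw [Finset.card_insert_of_notMem h5] at h2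
    omega
  rw [Finset.insert_eq_of_mem h5] at h2
  have h6 : π.cycleType.card = 1 := by omega
  rw [(Perm.card_cycleType_eq_one.mp h6).cycleType, h2]
  exact ⟨h5, rfl⟩

/-- Inserting a new point `a` before the point `i` of a cycle yields a longer cycle. -/
theorem isCycle_swap_mul_of_notMem {π : Perm (Fin d)} (hπ : π.IsCycle) {a i : Fin d}
    (hi : i ∈ π.support) (ha : a ∉ π.support) :
    (swap a i * π).IsCycle ∧ (swap a i * π).support = insert a π.support := by
  have hl := Perm.nodup_toList π i
  have hf : (π.toList i).formPerm = π := by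
    rw [Perm.formPerm_toList, hπ.cycleOf_eq (Perm.mem_support.mp hi)]
  have hmem : ∀ y, y ∈ π.toList i → y ∈ π.support := fun y hy => by
    obtain ⟨h1, h2⟩ := Perm.mem_toList_iff.mp hy
    exact h1.mem_support_iff.mp h2
  have h2 : 2 ≤ (π.toList i).length := Perm.two_le_length_toList_iff_mem_support.mpr hi
  have h0 : ∀ h : 0 < (π.toList i).length, (π.toList i)[0] = i :=
    fun _ => Perm.toList_getElem_zero _ _ hi
  generalize π.toList i = l at *
  match l with
  | [] => simp at h2
  | [x] => simp at h2
  | x :: y :: l =>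
    obtain rfl : x = i := h0 (by simp)
    have hn : (a :: x :: y :: l).Nodup :=
      List.nodup_cons.mpr ⟨fun h => ha (hmem a h), hl⟩
    have he : (a :: x :: y :: l).formPerm = swap a x * π := by
      rw [List.formPerm_cons_cons, hf]
    rw [← he]
    refine ⟨List.isCycle_formPerm hn (by simp), ?_⟩
    rw [List.support_formPerm_of_nodup _ hn (by simp), ← hf,
      List.support_formPerm_of_nodup _ hl (by simp), List.toFinset_cons]

theorem swap_mul_mem_cyclesThrough {i a : Fin d} {S : Finset (Fin d)} {k : ℕ}
    {π : Perm (Fin d)} (h : π ∈ cyclesThrough i S k) (ha : a ∈ S) (hai : a ≠ i)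
    (haπ : a ∉ π.support) : swap a i * π ∈ cyclesThrough i S (k + 1) := by
  obtain ⟨h1, h2, h3⟩ := mem_cyclesThrough.mp h
  rw [mem_cyclesThrough]
  by_cases hπ : π = 1
  · subst hπ
    rw [permNorm_one] at h1
    subst h1
    rw [mul_one, permNorm_swap hai, Perm.support_swap hai, Finset.insert_eq_of_mem (by simp)]
    refine ⟨rfl, Finset.card_pair hai, ?_⟩
    simp [Finset.insert_subset_iff, ha]
  · obtain ⟨hi, hc⟩ := cycleType_of_mem_cyclesThrough h hπ
    have hcy : π.IsCycle := Perm.card_cycleType_eq_one.mp (by simp [hc])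
    obtain ⟨h4, h5⟩ := isCycle_swap_mul_of_notMem hcy hi haπ
    have h6 := permNorm_of_isCycle h4
    rw [Finset.insert_eq_of_mem hi] at h2
    rw [h5, Finset.insert_eq_of_mem (by simp [hi]), Finset.card_insert_of_notMem haπ, h2]
    rw [h5, Finset.card_insert_of_notMem haπ, h2] at h6
    exact ⟨by omega, rfl, Finset.insert_subset (by simp [ha]) h3⟩

/-- In the graded group algebra a product `(a₁ i) * ⋯ * (a_k i)` survives only for distinct `a_j`,
and every cycle of length `k + 1` through `i` is such a product in exactly one way. -/
theorem jucysMurphy_pow (hT : IsGradedRep T) {i : Fin d} {S : Finset (Fin d)} (hi : i ∉ S)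
    (k : ℕ) : jucysMurphy T i S ^ k = ∑ π ∈ cyclesThrough i S k, T π := by
  have hne : ∀ a ∈ S, a ≠ i := fun a ha h => hi (h ▸ ha)
  induction k with
  | zero =>
    have : cyclesThrough i S 0 = {1} := by
      ext π
      rw [mem_cyclesThrough, permNorm_eq_zero_iff, Finset.mem_singleton]
      exact ⟨fun h => h.1, fun h => by simp [h]⟩
    rw [this, pow_zero, Finset.sum_singleton, hT.map_one]
  | succ k ih =>
    rw [pow_succ', ih, jucysMurphy, Finset.sum_mul_sum, ← Finset.sum_product']
    -- If `a` lies on the cycle already, the product moves too few points to have norm `k + 1`.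
    have hz : ∀ x ∈ S ×ˢ cyclesThrough i S k, T (swap x.1 i) * T x.2 ≠ 0 → x.1 ∉ x.2.support := by
      rintro ⟨a, π⟩ hx hne0 ha
      simp only [Finset.mem_product] at hx ha
      obtain ⟨h1, h2, -⟩ := mem_cyclesThrough.mp hx.2
      have hai := hne a hx.1
      refine hne0 (hT.map_mul_zero fun h => ?_)
      change permNorm (swap a i * π) = permNorm (swap a i) + permNorm π at h
      rw [permNorm_swap hai, h1] at h
      have hρ : swap a i * π ≠ 1 := fun h' => by
        rw [h', permNorm_one] at h
        omega
      have h3 := permNorm_lt_card_support hρ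
      have h4 : (swap a i * π).support ⊆ insert i π.support := by
        refine (Perm.support_mul_le _ _).trans ?_
        rw [Perm.support_swap hai, Finset.sup_eq_union]
        refine Finset.union_subset ?_ (Finset.subset_insert _ _)
        simp [Finset.insert_subset_iff, -Perm.mem_support, ha]
      have h5 := Finset.card_le_card h4
      omega
    rw [← Finset.sum_filter_of_ne hz]
    refine Finset.sum_bij' (fun x _ => swap x.1 i * x.2)
      (fun ρ _ => (ρ⁻¹ i, swap (ρ⁻¹ i) i * ρ)) ?_ ?_ ?_ ?_ ?_
    · rintro ⟨a, π⟩ hx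
      simp only [Finset.mem_filter, Finset.mem_product] at hx
      exact swap_mul_mem_cyclesThrough hx.1.2 hx.1.1 (hne a hx.1.1) hx.2
    · intro ρ hρ
      have hρ1 : ρ ≠ 1 := by
        rintro rfl
        have := (mem_cyclesThrough.mp hρ).1
        rw [permNorm_one] at this
        omega
      obtain ⟨h1, -, h3⟩ := mem_cyclesThrough.mp hρ
      obtain ⟨h4, h5⟩ := cycleType_of_mem_cyclesThrough hρ hρ1
      have hcard : ρ.support.card = k + 2 := by rw [← Perm.sum_cycleType, h5]; simp
      set a := ρ⁻¹ i with ha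
      have hρa : ρ a = i := by simp [ha]
      have hai : a ≠ i := by
        intro h
        rw [h] at hρa
        exact Perm.mem_support.mp h4 hρa
      have haρ : a ∈ ρ.support := by
        rw [Perm.mem_support, hρa]
        exact hai.symm
      have haS : a ∈ S := (Finset.mem_insert.mp (h3 haρ)).resolve_left hai
      have hafix : a ∉ (swap a i * ρ).support := by simp [hρa]
      have hsub : insert i (swap a i * ρ).support ⊆ ρ.support.erase a := by
        refine Finset.insert_subset (Finset.mem_erase.mpr ⟨hai.symm, h4⟩) fun x hx => ?_
        refine Finset.mem_erase.mpr ⟨fun h => hafix (h ▸ hx), ?_⟩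
        have := Perm.support_mul_le _ _ hx
        rw [Perm.support_swap hai, Finset.sup_eq_union, Finset.mem_union] at this
        rcases this with h | h
        · rcases Finset.mem_insert.mp h with rfl | h
          · exact haρ
          · rw [Finset.mem_singleton.mp h]; exact h4
        · exact h
      have h6 := Finset.card_le_card hsub
      rw [Finset.card_erase_of_mem haρ, hcard] at h6
      have h7 := Finset.card_le_card (Finset.subset_insert i (swap a i * ρ).support)
      have h8 := permNorm_mul_le (swap a i) (swap a i * ρ)
      rw [swap_mul_self_mul, permNorm_swap hai, h1] at h8
      have h9 : permNorm (swap a i * ρ) = k ∧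
          (insert i (swap a i * ρ).support).card = k + 1 := by
        by_cases hone : swap a i * ρ = 1
        · rw [hone, permNorm_one] at h8
          rw [hone, permNorm_one, Perm.support_one]
          simp
          omega
        · have := permNorm_lt_card_support hone
          omega
      simp only [Finset.mem_filter, Finset.mem_product]
      exact ⟨⟨haS, mem_cyclesThrough.mpr ⟨h9.1, h9.2,
        (Finset.subset_insert _ _).trans (hsub.trans ((Finset.erase_subset _ _).trans h3))⟩⟩, hafix⟩
    · rintro ⟨a, π⟩ hx
      simp only [Finset.mem_filter, Finset.mem_product] at hx
      have h1 : (swap a i * π)⁻¹ i = a := by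
        rw [Perm.inv_eq_iff_eq, Perm.mul_apply, Perm.notMem_support.mp hx.2, swap_apply_left]
      simp only [h1, swap_mul_self_mul]
    · intro ρ hρ
      simp
    · rintro ⟨a, π⟩ hx
      simp only [Finset.mem_filter, Finset.mem_product] at hx
      have h1 := (mem_cyclesThrough.mp hx.1.2).1
      have h2 := (mem_cyclesThrough.mp
        (swap_mul_mem_cyclesThrough hx.1.2 hx.1.1 (hne a hx.1.1) hx.2)).1
      refine hT.map_mul ?_
      rw [h2, h1, permNorm_swap (hne a hx.1.1), add_comm]

theorem jucysMurphy_pow_eq_zero (hT : IsGradedRep T) {i : Fin d} {S : Finset (Fin d)}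
    (hi : i ∉ S) : jucysMurphy T i S ^ d = 0 := by
  rw [jucysMurphy_pow hT hi, Finset.sum_eq_zero]
  intro π hπ
  have h1 := (mem_cyclesThrough.mp hπ).2.1
  have h2 := (insert i π.support).card_le_univ
  rw [Fintype.card_fin] at h2
  omega

/-- The power sums of the Jucys–Murphy elements over the complements of the points are multiples
of the sums of the cycles of a given length. -/
theorem sum_jucysMurphy_pow (hT : IsGradedRep T) {k : ℕ} (hk : k ≠ 0) :
    ∑ i, jucysMurphy T i (Finset.univ.erase i) ^ k
      = (k + 1) • ∑ π : Perm (Fin d) with π.cycleType = {k + 1}, T π := by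
  have h1 : ∀ i : Fin d, cyclesThrough i (Finset.univ.erase i) k
      = Finset.univ.filter fun π => π.cycleType = {k + 1} ∧ i ∈ π.support := by
    intro i
    ext π
    rw [Finset.mem_filter]
    constructor
    · intro h
      refine ⟨Finset.mem_univ _, (cycleType_of_mem_cyclesThrough h ?_).symm⟩
      rintro rfl
      have := (mem_cyclesThrough.mp h).1
      rw [permNorm_one] at this
      omega
    · rintro ⟨-, h2, h3⟩
      have h4 := permNorm_add_card_cycleType π
      rw [← Perm.sum_cycleType, h2] at h4
      simp only [Multiset.card_singleton, Multiset.sum_singleton] at h4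
      rw [mem_cyclesThrough, Finset.insert_eq_of_mem h3, ← Perm.sum_cycleType, h2]
      refine ⟨by omega, by simp, fun x _ => ?_⟩
      simp
  simp only [jucysMurphy_pow hT (Finset.notMem_erase _ _), h1]
  rw [Finset.smul_sum]
  simp only [← Finset.filter_filter]
  simp only [Finset.sum_filter (fun π : Perm (Fin d) => _ ∈ π.support)]
  rw [Finset.sum_comm]
  refine Finset.sum_congr rfl fun π hπ => ?_
  rw [← Finset.sum_filter, Finset.sum_const, Finset.filter_mem_eq_inter, Finset.univ_inter,
    ← Perm.sum_cycleType, (Finset.mem_filter.mp hπ).2, Multiset.sum_singleton]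

end

noncomputable section
open Equiv

/-! ### Sums of involutions -/

variable {d : ℕ} {E : Type*} [Ring E] {T : Perm (Fin d) → E}

/-- The sum of all involutions (the identity included) which move only points of `S`. -/
def involSum (T : Perm (Fin d) → E) (S : Finset (Fin d)) : E :=
  ∑ σ : Perm (Fin d) with σ * σ = 1 ∧ σ.support ⊆ S, T σ

/-- The sum of all involutions which move `i` and otherwise only points of `S`. -/
def involSumThrough (T : Perm (Fin d) → E) (i : Fin d) (S : Finset (Fin d)) : E :=
  ∑ b ∈ S, involSum T (S.erase b) * T (swap b i)

/-- An involution moving `i` to `b` is the product of the transposition `(b i)` and an involution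
disjoint from it. -/
theorem involSum_insert (hT : IsGradedRep T) {i : Fin d} {S : Finset (Fin d)} (hi : i ∉ S) :
    involSum T (insert i S) = involSum T S + involSumThrough T i S := by
  rw [involSum, ← Finset.sum_filter_add_sum_filter_not _ (fun σ : Perm (Fin d) => σ i = i)]
  congr 1
  · rw [involSum, Finset.filter_filter]
    refine Finset.sum_congr (Finset.filter_congr fun σ _ => ?_) fun _ _ => rfl
    rw [and_assoc, and_congr_right_iff]
    intro _
    rw [Finset.subset_insert_iff]
    constructor
    · rintro ⟨h1, h2⟩
      rwa [Finset.erase_eq_of_notMem (Perm.notMem_support.mpr h2)] at h1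
    · intro h
      exact ⟨(Finset.erase_subset _ _).trans h, Perm.notMem_support.mp fun h' => hi (h h')⟩
  · rw [Finset.filter_filter, involSumThrough]
    rw [← Finset.sum_fiberwise_of_maps_to (t := S) (g := fun σ : Perm (Fin d) => σ i)]
    · refine Finset.sum_congr rfl fun b hb => ?_
      have hbi : b ≠ i := fun h => hi (h ▸ hb)
      rw [involSum, Finset.sum_mul, Finset.filter_filter]
      refine Finset.sum_bij' (fun σ _ => σ * swap b i) (fun σ _ => σ * swap b i) ?_ ?_
        (fun σ _ => by simp [mul_assoc]) (fun σ _ => by simp [mul_assoc]) ?_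
      · intro σ hσ
        simp only [Finset.mem_filter, Finset.mem_univ, true_and] at hσ ⊢
        obtain ⟨⟨⟨h1, h2⟩, h3⟩, h4⟩ := hσ
        have h5 : σ b = i := by rw [← h4, ← Perm.mul_apply, h1, Perm.one_apply]
        have hc : σ * swap b i = swap b i * σ := by
          rw [swap_mul_eq_mul_swap σ b i]
          simp [Perm.inv_eq_iff_eq.mpr h4.symm, Perm.inv_eq_iff_eq.mpr h5.symm, swap_comm]
        refine ⟨?_, ?_⟩
        · calc σ * swap b i * (σ * swap b i) = (σ * swap b i) * (swap b i * σ) := by rw [hc]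
            _ = 1 := by rw [mul_assoc, swap_mul_self_mul, h1]
        · intro x hx
          rw [Perm.mem_support, Perm.mul_apply] at hx
          have hxb : x ≠ b := by
            rintro rfl
            rw [swap_apply_left, h4] at hx
            exact hx rfl
          have hxi : x ≠ i := by
            rintro rfl
            rw [swap_apply_right, h5] at hx
            exact hx rfl
          rw [swap_apply_of_ne_of_ne hxb hxi] at hx
          exact Finset.mem_erase.mpr ⟨hxb,
            (Finset.mem_insert.mp (h2 (Perm.mem_support.mpr hx))).resolve_left hxi⟩
      · intro σ hσ
        simp only [Finset.mem_filter, Finset.mem_univ, true_and] at hσ ⊢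
        obtain ⟨h1, h2⟩ := hσ
        have hb' : σ b = b := Perm.notMem_support.mp fun h => Finset.notMem_erase b S (h2 h)
        have hi' : σ i = i := Perm.notMem_support.mp fun h => hi (Finset.erase_subset _ _ (h2 h))
        have hc : σ * swap b i = swap b i * σ := by
          rw [mul_swap_eq_swap_mul, hb', hi']
        refine ⟨⟨⟨?_, ?_⟩, ?_⟩, ?_⟩
        · calc σ * swap b i * (σ * swap b i) = (σ * swap b i) * (swap b i * σ) := by rw [hc]
            _ = 1 := by rw [mul_assoc, swap_mul_self_mul, h1]
        · intro x hx
          have := Perm.support_mul_le _ _ hx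
          rw [Perm.support_swap hbi, Finset.sup_eq_union, Finset.mem_union] at this
          rcases this with h | h
          · exact Finset.mem_insert_of_mem (Finset.erase_subset _ _ (h2 h))
          · rcases Finset.mem_insert.mp h with rfl | h
            · exact Finset.mem_insert_of_mem hb
            · rw [Finset.mem_singleton.mp h]
              exact Finset.mem_insert_self _ _
        · simpa [hb'] using hbi
        · simp [hb']
      · intro σ hσ
        simp only [Finset.mem_filter, Finset.mem_univ, true_and] at hσ
        obtain ⟨⟨⟨h1, h2⟩, h3⟩, h4⟩ := hσ
        have h5 : σ b = i := by rw [← h4, ← Perm.mul_apply, h1, Perm.one_apply]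
        have hd : (σ * swap b i).Disjoint (swap b i) := by
          intro x
          by_cases hxb : x = b
          · left
            rw [hxb, Perm.mul_apply, swap_apply_left, h4]
          · by_cases hxi : x = i
            · left
              rw [hxi, Perm.mul_apply, swap_apply_right, h5]
            · exact Or.inr (swap_apply_of_ne_of_ne hxb hxi)
        rw [hT.map_mul (permNorm_mul_of_disjoint hd), mul_assoc, swap_mul_self, mul_one]
    · intro σ hσ
      simp only [Finset.mem_filter, Finset.mem_univ, true_and] at hσ
      obtain ⟨⟨-, h2⟩, h3⟩ := hσ
      have : σ i ∈ σ.support := Perm.apply_mem_support.mpr (Perm.mem_support.mpr h3)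
      exact (Finset.mem_insert.mp (h2 this)).resolve_left h3

/-- Multiplying by the transposition `(a i)` exchanges the Jucys–Murphy elements of `i` and `a`. -/
theorem semiconjBy_swap_jucysMurphy (hT : IsGradedRep T) {i a : Fin d} {S : Finset (Fin d)}
    (hi : i ∉ S) (ha : a ∈ S) :
    SemiconjBy (T (swap a i)) (jucysMurphy T i S) (jucysMurphy T a (S.erase a)) := by
  have hne : ∀ b ∈ S, b ≠ i := fun b hb h => hi (h ▸ hb)
  have hai := hne a ha
  rw [SemiconjBy, jucysMurphy, jucysMurphy, Finset.mul_sum, Finset.sum_mul,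
    ← Finset.add_sum_erase S _ ha]
  have h0 : T (swap a i) * T (swap a i) = 0 := hT.map_mul_zero (by
    rw [swap_mul_self, permNorm_one, permNorm_swap hai]; omega)
  rw [h0, zero_add]
  refine Finset.sum_congr rfl fun b hb => ?_
  obtain ⟨hba, hb⟩ := Finset.mem_erase.mp hb
  have hbi := hne b hb
  have h1 : swap a i * swap b i = swap b a * swap a i := by
    rw [mul_swap_eq_swap_mul, swap_apply_right, swap_apply_of_ne_of_ne hba hbi]
  have h2 : permNorm (swap a i * swap b i) = 2 := by
    have h3 : (swap a i * swap b i).IsThreeCycle := by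
      rw [swap_comm a i, swap_comm b i]
      exact Perm.isThreeCycle_swap_mul_swap_same hai.symm hbi.symm hba.symm
    have h4 := permNorm_of_isCycle h3.isCycle
    rw [h3.card_support] at h4
    omega
  rw [hT.map_mul (by rw [h2, permNorm_swap hai, permNorm_swap hbi]),
    hT.map_mul (by rw [← h1, h2, permNorm_swap hai, permNorm_swap hba]), h1]

open Polynomial

/-- The generating polynomial `∑ (-1) ^ k * catalan k * X ^ k`, `k < n`, of the signed Catalan
numbers. -/
def signedCatalan (n : ℕ) : ℚ[X] :=
  ∑ k ∈ Finset.range n, C ((-1) ^ k * (catalan k : ℚ)) * X ^ k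

theorem coeff_signedCatalan {n k : ℕ} (h : k < n) :
    (signedCatalan n).coeff k = (-1) ^ k * (catalan k : ℚ) := by
  simp only [signedCatalan, finsetSum_coeff, coeff_C_mul_X_pow]
  rw [Finset.sum_ite_eq, if_pos (Finset.mem_range.mpr h)]

/-- The functional equation `c + X * c ^ 2 = 1` of the signed Catalan numbers. -/
theorem X_pow_dvd_signedCatalan (n : ℕ) :
    X ^ n ∣ signedCatalan n + X * signedCatalan n ^ 2 - 1 := by
  rw [X_pow_dvd_iff]
  intro k hk
  cases k with
  | zero => simp [coeff_signedCatalan hk]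
  | succ k =>
    rw [coeff_sub, coeff_add, coeff_X_mul, coeff_signedCatalan hk, sq, coeff_mul, coeff_one,
      if_neg (Nat.succ_ne_zero k), catalan_succ']
    have : ∀ x ∈ Finset.HasAntidiagonal.antidiagonal k,
        (signedCatalan n).coeff x.1 * (signedCatalan n).coeff x.2
          = (-1) ^ k * ((catalan x.1 : ℚ) * catalan x.2) := by
      intro x hx
      have hx := Finset.HasAntidiagonal.mem_antidiagonal.mp hx
      rw [coeff_signedCatalan (by omega), coeff_signedCatalan (by omega), ← hx, pow_add]
      ring
    rw [Finset.sum_congr rfl this, ← Finset.mul_sum]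
    push_cast
    ring

variable [Algebra ℚ E]

theorem aeval_signedCatalan_add (hT : IsGradedRep T) {i : Fin d} {S : Finset (Fin d)}
    (hi : i ∉ S) :
    aeval (jucysMurphy T i S) (signedCatalan d + X * signedCatalan d ^ 2) = 1 := by
  obtain ⟨q, hq⟩ := X_pow_dvd_signedCatalan d
  rw [eq_add_of_sub_eq hq, map_add, map_mul, map_pow, aeval_X, jucysMurphy_pow_eq_zero hT hi,
    zero_mul, zero_add, map_one]

/-- With `c` the signed Catalan series, the involutions moving `i` arise from those fixing `i` on
multiplication by `J * c(J)`, where `J` is the Jucys–Murphy element of `i`. -/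
theorem involSumThrough_eq (hT : IsGradedRep T) {i : Fin d} {S : Finset (Fin d)} (hi : i ∉ S) :
    involSumThrough T i S
      = involSum T S * aeval (jucysMurphy T i S) (X * signedCatalan d) := by
  induction hn : S.card generalizing i S with
  | zero =>
    rw [Finset.card_eq_zero] at hn
    subst hn
    simp [involSumThrough, jucysMurphy]
  | succ n ih =>
    set J := jucysMurphy T i S
    -- For each `a`, split the involutions on `S` by whether they move `a`, and apply the inductive
    -- hypothesis to the Jucys–Murphy element of `a`; the transposition `(a i)` turns it into `J`.
    have h1 : involSum T S * J
        = involSumThrough T i S + involSumThrough T i S * aeval J (X * signedCatalan d) := by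
      have h2 : ∀ a ∈ S, involSum T S * T (swap a i) = involSum T (S.erase a) * T (swap a i)
          + involSum T (S.erase a) * T (swap a i) * aeval J (X * signedCatalan d) := by
        intro a ha
        have h3 : involSum T S = involSum T (S.erase a) + involSumThrough T a (S.erase a) := by
          rw [← involSum_insert hT (Finset.notMem_erase a S), Finset.insert_erase ha]
        have h4 := (semiconjBy_swap_jucysMurphy hT hi ha)
        have h5 : SemiconjBy (T (swap a i)) (aeval J (X * signedCatalan d))
            (aeval (jucysMurphy T a (S.erase a)) (X * signedCatalan d)) := by
          generalize X * signedCatalan d = p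
          induction p using Polynomial.induction_on' with
          | add p q hp hq => simpa using hp.add_right hq
          | monomial k r =>
            rw [aeval_monomial, aeval_monomial]
            exact SemiconjBy.mul_right (Algebra.commutes r _).symm (h4.pow_right k)
        rw [h3, add_mul,
          ih (Finset.notMem_erase a S) (by rw [Finset.card_erase_of_mem ha, hn]; rfl),
          mul_assoc _ _ (T (swap a i)), ← h5.eq, mul_assoc]
      rw [show J = ∑ a ∈ S, T (swap a i) from rfl, Finset.mul_sum, Finset.sum_congr rfl h2,
        Finset.sum_add_distrib, ← Finset.sum_mul]
      rfl
    have h6 : (1 + aeval J (X * signedCatalan d)) * aeval J (signedCatalan d) = 1 := by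
      refine Eq.trans ?_ (aeval_signedCatalan_add hT hi)
      rw [← map_one (aeval (R := ℚ) J), ← map_add, ← map_mul]
      congr 1
      ring
    calc involSumThrough T i S
        = (involSumThrough T i S + involSumThrough T i S * aeval J (X * signedCatalan d))
            * aeval J (signedCatalan d) := by
          rw [← mul_one_add, mul_assoc, h6, mul_one]
      _ = _ := by rw [← h1, mul_assoc, map_mul, aeval_X]

/-- The involutions moving `i`, as a multiple of the sum of all involutions. -/
theorem involSum_univ_sub (hT : IsGradedRep T) (i : Fin d) :
    involSum T Finset.univ - involSum T (Finset.univ.erase i)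
      = involSum T Finset.univ *
        (1 - aeval (jucysMurphy T i (Finset.univ.erase i)) (signedCatalan d)) := by
  have hi : i ∉ Finset.univ.erase i := Finset.notMem_erase i _
  have h1 := involSum_insert hT hi
  rw [Finset.insert_erase (Finset.mem_univ i)] at h1
  have h2 := involSumThrough_eq hT hi
  set J := jucysMurphy T i (Finset.univ.erase i)
  rw [← map_one (aeval (R := ℚ) J), ← map_sub, h1, add_sub_cancel_left, h2, ← mul_one_add,
    mul_assoc, ← map_one (aeval (R := ℚ) J), ← map_add, ← map_mul]
  have h3 : aeval J ((1 + X * signedCatalan d) * (1 - signedCatalan d))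
      = aeval J (1 + X * signedCatalan d)
        - aeval J (signedCatalan d + X * signedCatalan d ^ 2) := by
    rw [← map_sub]
    congr 1
    ring
  rw [h3, aeval_signedCatalan_add hT hi, map_add, map_one, add_sub_cancel_left]

theorem one_sub_aeval_signedCatalan (hd : d ≠ 0) (J : E) :
    1 - aeval J (signedCatalan d)
      = ∑ k ∈ Finset.range (d - 1), ((-1) ^ k * (catalan (k + 1) : ℚ)) • J ^ (k + 1) := by
  obtain ⟨n, rfl⟩ := Nat.exists_eq_succ_of_ne_zero hd
  rw [signedCatalan, Finset.sum_range_succ', map_add, map_sum]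
  simp only [C_mul_X_pow_eq_monomial, aeval_monomial, ← Algebra.smul_def]
  simp only [pow_zero, catalan_zero, Nat.cast_one, mul_one, one_smul, Nat.succ_eq_add_one,
    Nat.add_sub_cancel]
  rw [sub_add_eq_sub_sub_swap, sub_self, zero_sub, ← Finset.sum_neg_distrib]
  refine Finset.sum_congr rfl fun k _ => ?_
  rw [← neg_smul, pow_succ]
  congr 1
  ring

/-- Counting every involution with the number of points it moves expresses the sum as a multiple of
the sum of all involutions by a linear combination of the sums of `k`-cycles. -/
theorem sum_card_support_smul_invol (hT : IsGradedRep T) :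
    ∑ σ : Perm (Fin d) with σ * σ = 1, σ.support.card • T σ
      = (∑ σ : Perm (Fin d) with σ * σ = 1, T σ) * ∑ k ∈ Finset.range (d - 1),
        ((-1) ^ k * (catalan (k + 1) : ℚ) * (k + 2)) •
          ∑ π : Perm (Fin d) with π.cycleType = {k + 2}, T π := by
  have h0 : involSum T Finset.univ = ∑ σ : Perm (Fin d) with σ * σ = 1, T σ := by
    simp [involSum]
  have h1 : ∀ i : Fin d, involSum T Finset.univ - involSum T (Finset.univ.erase i)
      = ∑ σ : Perm (Fin d) with σ * σ = 1, if i ∈ σ.support then T σ else 0 := by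
    intro i
    rw [h0, sub_eq_iff_eq_add, involSum]
    rw [← Finset.sum_filter, Finset.filter_filter,
      ← Finset.sum_filter_add_sum_filter_not _ (fun σ : Perm (Fin d) => i ∈ σ.support),
      Finset.filter_filter, Finset.filter_filter]
    congr 2
    refine Finset.filter_congr fun σ _ => ?_
    rw [Finset.subset_erase]
    simp
  have h2 : ∑ i, (involSum T Finset.univ - involSum T (Finset.univ.erase i))
      = ∑ σ : Perm (Fin d) with σ * σ = 1, σ.support.card • T σ := by
    simp only [h1]
    rw [Finset.sum_comm]
    refine Finset.sum_congr rfl fun σ _ => ?_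
    rw [← Finset.sum_filter, Finset.sum_const, Finset.filter_mem_eq_inter, Finset.univ_inter]
  rw [← h2, ← h0, Finset.sum_congr rfl fun i _ => involSum_univ_sub hT i, ← Finset.mul_sum]
  congr 1
  rcases eq_or_ne d 0 with rfl | hd
  · simp
  · simp only [one_sub_aeval_signedCatalan hd]
    rw [Finset.sum_comm]
    refine Finset.sum_congr rfl fun k _ => ?_
    rw [← Finset.smul_sum, sum_jucysMurphy_pow hT (Nat.succ_ne_zero k),
      ← Nat.cast_smul_eq_nsmul ℚ, smul_smul]
    push_cast
    rw [show (k : ℚ) + 1 + 1 = k + 2 by ring]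

end

noncomputable section
open Equiv

/-! ### The relation of degree greater than `d / 2` -/

variable {d : ℕ} {E : Type*} [Ring E] {T : Perm (Fin d) → E}

open Polynomial in
/-- Recording the norm by the exponent of a variable preserves the multiplication rule. -/
theorem IsGradedRep.polynomial (hT : IsGradedRep T) :
    IsGradedRep fun σ => (monomial (permNorm σ) (T σ) : E[X]) where
  map_one := by rw [permNorm_one, hT.map_one, monomial_zero_one]
  map_mul h := by rw [monomial_mul_monomial, hT.map_mul h, h]
  map_mul_zero h := by rw [monomial_mul_monomial, hT.map_mul_zero h, monomial_zero_right]

theorem permNorm_add_one_of_cycleType {k : ℕ} {π : Perm (Fin d)} (h : π.cycleType = {k}) :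
    permNorm π + 1 = k := by
  have h1 := permNorm_add_card_cycleType π
  rwa [← Perm.sum_cycleType, h, Multiset.card_singleton, Multiset.sum_singleton] at h1

variable [Algebra ℚ E]

open Polynomial in
/-- The homogeneous parts of `sum_card_support_smul_invol`. -/
theorem sum_card_support_smul_invol_permNorm (hT : IsGradedRep T) (n : ℕ) :
    ∑ σ : Perm (Fin d) with σ * σ = 1 ∧ permNorm σ = n, σ.support.card • T σ
      = ∑ k ∈ Finset.range (d - 1), ((-1) ^ k * (catalan (k + 1) : ℚ) * (k + 2)) •
          if k + 1 ≤ n then (∑ σ : Perm (Fin d) with σ * σ = 1 ∧ permNorm σ = n - (k + 1), T σ) *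
            ∑ π : Perm (Fin d) with π.cycleType = {k + 2}, T π else 0 := by
  have h := congrArg (fun p : E[X] => p.coeff n) (sum_card_support_smul_invol hT.polynomial)
  have hc : ∀ k, ∑ π : Perm (Fin d) with π.cycleType = {k + 2},
      (monomial (permNorm π) (T π) : E[X])
        = C (∑ π : Perm (Fin d) with π.cycleType = {k + 2}, T π) * X ^ (k + 1) := by
    intro k
    rw [C_mul_X_pow_eq_monomial, map_sum]
    refine Finset.sum_congr rfl fun π hπ => ?_
    have := permNorm_add_one_of_cycleType (Finset.mem_filter.mp hπ).2
    rw [show permNorm π = k + 1 by omega]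
  simp only [hc, Finset.mul_sum, mul_smul_comm, finsetSum_coeff, coeff_smul, ← mul_assoc,
    coeff_mul_X_pow', coeff_mul_C, coeff_monomial, smul_ite, smul_zero, ← Finset.sum_filter,
    Finset.filter_filter] at h
  simp only [smul_ite, smul_zero, ← Finset.sum_filter, Finset.mul_sum]
  exact h

/-- Beyond half the number of letters there is no involution of norm `n`, whence the sum of the
`(n + 1)`-cycles lies in every subalgebra which contains the involutions and the cycles of smaller
norm. -/
theorem sum_cycles_mem_of_lt (hT : IsGradedRep T) {B : Subalgebra ℚ E} {n : ℕ} (hn : d < 2 * n)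
    (hinv : ∀ j < n, ∑ σ : Perm (Fin d) with σ * σ = 1 ∧ permNorm σ = j, T σ ∈ B)
    (hcyc : ∀ k < n, k ≠ 0 → ∑ π : Perm (Fin d) with π.cycleType = {k + 1}, T π ∈ B) :
    ∑ π : Perm (Fin d) with π.cycleType = {n + 1}, T π ∈ B := by
  rcases le_or_gt d n with hdn | hdn
  · rw [Finset.sum_eq_zero]
    · exact B.zero_mem
    · intro π hπ
      have h1 := π.sum_cycleType_le
      rw [(Finset.mem_filter.mp hπ).2, Multiset.sum_singleton, Fintype.card_fin] at h1
      omega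
  -- The term of index `m` in the relation of degree `m + 1` is a nonzero multiple of the cycle sum.
  obtain ⟨m, rfl⟩ : ∃ m, n = m + 1 := ⟨n - 1, by omega⟩
  have h := sum_card_support_smul_invol_permNorm hT (m + 1)
  rw [Finset.sum_eq_zero, ← Finset.add_sum_erase _ _ (Finset.mem_range.mpr (by omega : m < d - 1)),
    if_pos le_rfl, Nat.sub_self] at h
  · have h1 : ∑ σ : Perm (Fin d) with σ * σ = 1 ∧ permNorm σ = 0, T σ = 1 := by
      rw [← hT.map_one, ← Finset.sum_singleton T 1]
      congr 1
      ext σ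
      simp only [Finset.mem_filter, Finset.mem_univ, true_and, permNorm_eq_zero_iff,
        Finset.mem_singleton]
      exact ⟨fun h => h.2, fun h => by simp [h]⟩
    rw [h1, one_mul] at h
    have h2 := eq_neg_of_add_eq_zero_left h.symm
    have h3 : (-1 : ℚ) ^ m * (catalan (m + 1) : ℚ) * (m + 2) ≠ 0 := by
      have h4 : catalan (m + 1) ≠ 0 := by
        intro h5
        have h6 := succ_mul_catalan_eq_centralBinom (m + 1)
        rw [h5, mul_zero] at h6
        exact (Nat.centralBinom_ne_zero _) h6.symm
      have h5 : (m : ℚ) + 2 ≠ 0 := by positivity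
      have h6 : (catalan (m + 1) : ℚ) ≠ 0 := by exact_mod_cast h4
      exact mul_ne_zero (mul_ne_zero (pow_ne_zero _ (by norm_num)) h6) h5
    rw [(eq_inv_smul_iff₀ h3).mpr h2]
    refine B.smul_mem (B.neg_mem (B.sum_mem fun k hk => B.smul_mem ?_ _)) _
    obtain ⟨hkm, hk⟩ := Finset.mem_erase.mp hk
    split_ifs with h4
    · exact B.mul_mem (hinv _ (by omega)) (hcyc (k + 1) (by omega) (by omega))
    · exact B.zero_mem
  · intro σ hσ
    obtain ⟨-, h1, h2⟩ := Finset.mem_filter.mp hσ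
    have h3 : σ ^ 2 = 1 := by rw [sq, h1]
    have h4 := permNorm_add_card_cycleType σ
    have h5 := σ.support.card_le_univ
    have h6 : ∀ x ∈ σ.cycleType, x = 2 := fun x hx =>
      le_antisymm (Nat.le_of_dvd (by norm_num)
        ((Perm.dvd_of_mem_cycleType hx).trans (orderOf_dvd_of_pow_eq_one h3)))
        (Perm.two_le_of_mem_cycleType hx)
    have h7 := Multiset.eq_replicate_card.mpr h6
    have h8 := congrArg Multiset.sum h7
    rw [Perm.sum_cycleType, Multiset.sum_replicate, smul_eq_mul] at h8
    rw [Fintype.card_fin] at h5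
    omega

/-! ### Class functions and generation by cycles -/

/-- The element `∑ f σ * T σ` attached to a function on the symmetric group. -/
def repSum (T : Perm (Fin d) → E) (f : Perm (Fin d) → ℚ) : E := ∑ σ, f σ • T σ

/-- The element attached to the class of the permutations of cycle type `ν`. -/
def classRep (T : Perm (Fin d) → E) (ν : Multiset ℕ) : E :=
  ∑ σ : Perm (Fin d) with σ.cycleType = ν, T σ

/-- A function on the symmetric group which depends on the cycle type only. -/
def IsClassFn (f : Perm (Fin d) → ℚ) : Prop :=
  ∀ σ τ : Perm (Fin d), σ.cycleType = τ.cycleType → f σ = f τ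

theorem IsClassFn.of_conj {f : Perm (Fin d) → ℚ} (h : ∀ σ τ, f (τ * σ * τ⁻¹) = f σ) :
    IsClassFn f := by
  intro σ τ hst
  obtain ⟨c, hc⟩ := isConj_iff.mp (Perm.isConj_iff_cycleType_eq.mpr hst)
  rw [← hc, h]

theorem repSum_indicator (ν : Multiset ℕ) :
    repSum T (fun σ => if σ.cycleType = ν then 1 else 0) = classRep T ν := by
  simp [repSum, classRep, Finset.sum_filter]

theorem isClassFn_indicator (ν : Multiset ℕ) :
    IsClassFn fun σ : Perm (Fin d) => if σ.cycleType = ν then 1 else 0 := by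
  intro σ τ h
  simp only [h]

theorem repSum_mem {f : Perm (Fin d) → ℚ} (hf : IsClassFn f) {B : Submodule ℚ E}
    (hB : ∀ π, f π ≠ 0 → classRep T π.cycleType ∈ B) : repSum T f ∈ B := by
  rw [repSum, ← Finset.sum_fiberwise_of_maps_to (t := Finset.univ.image Perm.cycleType)
    (fun σ _ => Finset.mem_image_of_mem _ (Finset.mem_univ σ))]
  refine B.sum_mem fun ν hν => ?_
  obtain ⟨π, -, rfl⟩ := Finset.mem_image.mp hν
  have h1 : ∑ σ : Perm (Fin d) with σ.cycleType = π.cycleType, f σ • T σ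
      = f π • classRep T π.cycleType := by
    rw [classRep, Finset.smul_sum]
    exact Finset.sum_congr rfl fun σ hσ => by rw [hf σ π (Finset.mem_filter.mp hσ).2]
  rw [h1]
  by_cases h2 : f π = 0
  · rw [h2, zero_smul]
    exact B.zero_mem
  · exact B.smul_mem _ (hB π h2)

/-- The convolution of functions on the symmetric group, restricted to the factorizations for which
the norms add up. -/
def gradedConv (f g : Perm (Fin d) → ℚ) (π : Perm (Fin d)) : ℚ :=
  ∑ σ, if permNorm π = permNorm σ + permNorm (σ⁻¹ * π) then f σ * g (σ⁻¹ * π) else 0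

theorem repSum_mul_repSum (hT : IsGradedRep T) (f g : Perm (Fin d) → ℚ) :
    repSum T f * repSum T g = repSum T (gradedConv f g) := by
  simp only [repSum, gradedConv, Finset.sum_mul_sum, Finset.sum_smul]
  rw [Finset.sum_comm (γ := Perm (Fin d)) (s := Finset.univ) (t := Finset.univ)
    (f := fun π σ => (if permNorm π = permNorm σ + permNorm (σ⁻¹ * π) then
      f σ * g (σ⁻¹ * π) else 0) • T π)]
  refine Finset.sum_congr rfl fun σ _ => ?_
  rw [← Equiv.sum_comp (Equiv.mulLeft σ) (fun π => (if permNorm π = permNorm σ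
    + permNorm (σ⁻¹ * π) then f σ * g (σ⁻¹ * π) else 0) • T π)]
  refine Finset.sum_congr rfl fun τ _ => ?_
  rw [Equiv.coe_mulLeft, inv_mul_cancel_left, smul_mul_smul_comm]
  split_ifs with h
  · rw [hT.map_mul h]
  · rw [hT.map_mul_zero h, smul_zero, zero_smul]

theorem IsClassFn.gradedConv {f g : Perm (Fin d) → ℚ} (hf : IsClassFn f) (hg : IsClassFn g) :
    IsClassFn (gradedConv f g) := by
  refine IsClassFn.of_conj fun π c => ?_
  rw [_root_.gradedConv, _root_.gradedConv, ← Equiv.sum_comp (MulAut.conj c).toEquiv]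
  refine Finset.sum_congr rfl fun σ _ => ?_
  have h1 : (c * σ * c⁻¹)⁻¹ * (c * π * c⁻¹) = c * (σ⁻¹ * π) * c⁻¹ := by group
  change (if permNorm (c * π * c⁻¹) = permNorm (c * σ * c⁻¹)
    + permNorm ((c * σ * c⁻¹)⁻¹ * (c * π * c⁻¹)) then
      f (c * σ * c⁻¹) * g ((c * σ * c⁻¹)⁻¹ * (c * π * c⁻¹)) else 0) = _
  rw [h1, permNorm_conj, permNorm_conj, permNorm_conj, hf _ σ Perm.cycleType_conj,
    hg _ (σ⁻¹ * π) Perm.cycleType_conj]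

/-- The coefficients of the product of a class and the class of the `k`-cycles: apart from the
class in which the two are disjoint, only classes with fewer cycles occur. -/
theorem gradedConv_indicator_ne_zero {μ : Multiset ℕ} {k : ℕ} {π : Perm (Fin d)}
    (h : gradedConv (fun σ => if σ.cycleType = μ then 1 else 0)
      (fun σ => if σ.cycleType = {k} then 1 else 0) π ≠ 0) :
    (∃ σ τ : Perm (Fin d), σ.cycleType = μ ∧ τ.cycleType = {k} ∧
      permNorm π = permNorm σ + permNorm τ) ∧
    (π.cycleType.card < μ.card + 1 ∨ π.cycleType = μ + {k}) := by
  obtain ⟨σ, -, hσ⟩ := Finset.exists_ne_zero_of_sum_ne_zero h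
  have h1 : permNorm π = permNorm σ + permNorm (σ⁻¹ * π) := by
    by_contra h1
    exact hσ (if_neg h1)
  rw [if_pos h1] at hσ
  have h2 : σ.cycleType = μ := by
    by_contra h2
    exact hσ (by simp [h2])
  have h3 : (σ⁻¹ * π).cycleType = {k} := by
    by_contra h3
    exact hσ (by simp [h3])
  refine ⟨⟨σ, _, h2, h3, h1⟩, ?_⟩
  have h4 : permNorm (σ * (σ⁻¹ * π)) = permNorm σ + permNorm (σ⁻¹ * π) := by
    rwa [mul_inv_cancel_left]
  rcases card_cycleType_mul_lt_or_disjoint h4 with h5 | h5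
  · rw [mul_inv_cancel_left, h2, h3, Multiset.card_singleton] at h5
    exact Or.inl h5
  · have h6 := h5.cycleType_mul
    rw [mul_inv_cancel_left, h2, h3] at h6
    exact Or.inr h6

/-- The class of the disjoint products occurs in the product of the two classes. -/
theorem gradedConv_indicator_pos {k : ℕ} {σ τ : Perm (Fin d)} (h : σ.Disjoint τ)
    (hτ : τ.cycleType = {k}) :
    0 < gradedConv (fun ρ => if ρ.cycleType = σ.cycleType then 1 else 0)
      (fun ρ => if ρ.cycleType = {k} then 1 else 0) (σ * τ) := by
  refine Finset.sum_pos' (fun ρ _ => ?_) ⟨σ, Finset.mem_univ σ, ?_⟩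
  · dsimp only
    split_ifs <;> norm_num
  · dsimp only
    rw [inv_mul_cancel_left, if_pos (permNorm_mul_of_disjoint h), if_pos rfl, if_pos hτ]
    norm_num

/-- A subalgebra which contains the sums of the `k`-cycles for `k ≤ d / 2 + 1` contains all class
sums. -/
theorem classRep_mem (hT : IsGradedRep T) {B : Subalgebra ℚ E}
    (hB : ∀ k ∈ Set.Icc 2 (d / 2 + 1), classRep T {k} ∈ B) (π : Perm (Fin d)) :
    classRep T π.cycleType ∈ B := by
  induction hn : permNorm π using Nat.strong_induction_on generalizing π with | _ n ih
  -- The sums over the classes of a given norm are obtained by induction on the number of cycles.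
  induction hc : π.cycleType.card using Nat.strong_induction_on generalizing π with | _ c ihc
  have hsum : ∀ j < n, ∀ f : Perm (Fin d) → ℚ, IsClassFn f → (∀ σ, f σ ≠ 0 → permNorm σ = j) →
      repSum T f ∈ B := fun j hj f hf hfj =>
    repSum_mem (B := Subalgebra.toSubmodule B) hf fun σ hσ => ih j hj σ (hfj σ hσ)
  have hcyc : ∀ k < n, k ≠ 0 → classRep T {k + 1} ∈ B := by
    intro k hk hk0
    rw [← repSum_indicator]
    refine hsum k hk _ (isClassFn_indicator _) fun σ hσ => ?_
    have h1 : σ.cycleType = {k + 1} := by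
      by_contra h
      exact hσ (if_neg h)
    have := permNorm_add_one_of_cycleType h1
    omega
  rcases Nat.lt_trichotomy c 1 with hc1 | rfl | hc1
  · have h1 : π = 1 := Perm.card_cycleType_eq_zero.mp (by omega)
    have h2 : classRep T π.cycleType = 1 := by
      rw [h1, Perm.cycleType_one, classRep, ← hT.map_one, ← Finset.sum_singleton T 1]
      congr 1
      ext σ
      simp [Perm.cycleType_eq_zero]
    rw [h2]
    exact B.one_mem
  · obtain ⟨k, hk⟩ := Multiset.card_eq_one.mp hc
    have h1 := permNorm_add_one_of_cycleType hk
    have h2 : 2 ≤ k := Perm.two_le_of_mem_cycleType (σ := π) (by simp [hk])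
    rw [hk]
    -- Beyond the generators, the cycle sum is decomposable by the relation between involutions.
    by_cases h3 : k ≤ d / 2 + 1
    · exact hB k ⟨h2, h3⟩
    · obtain rfl : k = n + 1 := by omega
      refine sum_cycles_mem_of_lt hT (by omega) (fun j hj => ?_) hcyc
      have h4 : ∑ σ : Perm (Fin d) with σ * σ = 1 ∧ permNorm σ = j, T σ
          = repSum T fun σ => if σ * σ = 1 ∧ permNorm σ = j then 1 else 0 := by
        simp [repSum, Finset.sum_filter]
      rw [h4]
      refine hsum j hj _ (IsClassFn.of_conj fun σ τ => ?_) fun σ hσ => ?_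
      · have h5 : τ * σ * τ⁻¹ * (τ * σ * τ⁻¹) = 1 ↔ σ * σ = 1 := by
          rw [show τ * σ * τ⁻¹ * (τ * σ * τ⁻¹) = τ * (σ * σ) * τ⁻¹ by group, conj_eq_one_iff]
        simp only [h5, permNorm_conj]
      · by_contra h
        exact hσ (if_neg fun h' => h h'.2)
  -- With at least two cycles, split off one of them and multiply the two classes.
  · obtain ⟨k, hk⟩ := Multiset.card_pos_iff_exists_mem.mp (by omega : 0 < π.cycleType.card)
    obtain ⟨τ, σ, hπ, hd, hτ, hτk⟩ := Perm.mem_cycleType_iff.mp hk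
    have hτ' : τ.cycleType = {k} := by rw [hτ.cycleType, hτk]
    have hd' : σ.Disjoint τ := hd.symm
    have hπ' : π = σ * τ := by rw [hπ, hd.commute.eq]
    have hk2 := Perm.two_le_of_mem_cycleType hk
    have h1 := permNorm_mul_of_disjoint hd'
    have h2 := permNorm_add_one_of_cycleType hτ'
    have h3 : π.cycleType.card = σ.cycleType.card + 1 := by
      rw [hπ', hd'.cycleType_mul, hτ', Multiset.card_add, Multiset.card_singleton]
    have h4 : permNorm σ ≠ 0 := by
      rw [Ne, permNorm_eq_zero_iff, ← Perm.card_cycleType_eq_zero]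
      omega
    rw [← hπ', hn] at h1
    set h := gradedConv (fun ρ : Perm (Fin d) => if ρ.cycleType = σ.cycleType then 1 else 0)
      (fun ρ => if ρ.cycleType = {k} then 1 else 0) with hh
    have hprod : repSum T h ∈ B := by
      rw [hh, ← repSum_mul_repSum hT, repSum_indicator, repSum_indicator]
      refine B.mul_mem (ih _ (by omega) σ rfl) ?_
      have := hcyc (k - 1) (by omega) (by omega)
      rwa [Nat.sub_add_cancel (by omega)] at this
    have hcl : IsClassFn h := (isClassFn_indicator _).gradedConv (isClassFn_indicator _)
    have hpos : 0 < h π := by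
      rw [hπ']
      exact gradedConv_indicator_pos hd' hτ'
    have hne : ∀ ρ, h ρ ≠ 0 → permNorm ρ = n ∧
        (ρ.cycleType.card < c ∨ ρ.cycleType = π.cycleType) := by
      intro ρ hρ
      obtain ⟨⟨σ', τ', h5, h6, h7⟩, h8⟩ := gradedConv_indicator_ne_zero hρ
      rw [permNorm_eq_of_cycleType_eq h5, permNorm_eq_of_cycleType_eq (h6.trans hτ'.symm)] at h7
      refine ⟨by omega, h8.imp (fun h => by omega) fun h => ?_⟩
      rw [h, hπ', hd'.cycleType_mul, hτ']
    have hrest : repSum T (fun ρ => if ρ.cycleType = π.cycleType then 0 else h ρ) ∈ B := by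
      refine repSum_mem (B := Subalgebra.toSubmodule B) (fun ρ ρ' h5 => ?_) fun ρ hρ => ?_
      · simp only [h5, hcl ρ ρ' h5]
      · have h5 : ρ.cycleType ≠ π.cycleType := fun h5 => hρ (if_pos h5)
        rw [if_neg h5] at hρ
        obtain ⟨h6, h7⟩ := hne ρ hρ
        exact ihc _ (h7.resolve_right h5) ρ h6 rfl
    have hsplit : repSum T h = h π • classRep T π.cycleType
        + repSum T (fun ρ => if ρ.cycleType = π.cycleType then 0 else h ρ) := by
      rw [← repSum_indicator, repSum, repSum, repSum, Finset.smul_sum, ← Finset.sum_add_distrib]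
      refine Finset.sum_congr rfl fun ρ _ => ?_
      split_ifs with h5
      · rw [hcl ρ π h5, one_smul, zero_smul, add_zero]
      · rw [zero_smul, smul_zero, zero_add]
    rw [(eq_inv_smul_iff₀ hpos.ne').mpr (eq_sub_of_add_eq hsplit.symm)]
    exact B.smul_mem (B.sub_mem hprod hrest) _

end

noncomputable section
open Equiv

/-! ### The regular representation of the graded group algebra -/

/-- The operator of left multiplication by `σ` in the graded group algebra. -/
def gradedRep {d : ℕ} (σ : Perm (Fin d)) : Module.End ℚ (Perm (Fin d) →₀ ℚ) :=
  Finsupp.linearCombination ℚ fun ρ =>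
    if permNorm (σ * ρ) = permNorm σ + permNorm ρ then Finsupp.single (σ * ρ) 1 else 0

theorem gradedRep_single {d : ℕ} (σ ρ : Perm (Fin d)) :
    gradedRep σ (Finsupp.single ρ 1)
      = if permNorm (σ * ρ) = permNorm σ + permNorm ρ then Finsupp.single (σ * ρ) 1 else 0 := by
  rw [gradedRep, Finsupp.linearCombination_single, one_smul]

theorem isGradedRep_gradedRep (d : ℕ) : IsGradedRep (gradedRep (d := d)) where
  map_one := by
    ext1 ρ
    ext1
    simp [gradedRep_single, permNorm_one]
  map_mul {σ τ} h := by
    ext1 ρ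
    ext1
    have h1 := permNorm_mul_le σ (τ * ρ)
    have h2 := permNorm_mul_le τ ρ
    simp only [LinearMap.comp_apply, Finsupp.lsingle_apply, Module.End.mul_apply,
      gradedRep_single, mul_assoc] at *
    split_ifs with h3 h4 h4
    · rw [gradedRep_single, if_pos (by omega)]
    · rw [gradedRep_single, if_neg (by omega)]
    · omega
    · rw [map_zero]
  map_mul_zero {σ τ} h := by
    ext1 ρ
    ext1
    have h1 := permNorm_mul_le σ τ
    have h2 := permNorm_mul_le (σ * τ) ρ
    simp only [LinearMap.comp_apply, Finsupp.lsingle_apply, Module.End.mul_apply,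
      gradedRep_single, mul_assoc, LinearMap.zero_apply] at *
    split_ifs with h3
    · rw [gradedRep_single, if_neg (by omega)]
    · rw [map_zero]

/-- The coefficient at `π` of an element of the graded group algebra, acting as an operator. -/
def coeffAt {d : ℕ} (π : Perm (Fin d)) : Module.End ℚ (Perm (Fin d) →₀ ℚ) →ₗ[ℚ] ℚ :=
  Finsupp.lapply π ∘ₗ LinearMap.applyₗ (Finsupp.single 1 1)

theorem coeffAt_gradedRep {d : ℕ} (π σ : Perm (Fin d)) :
    coeffAt π (gradedRep σ) = if σ = π then 1 else 0 := by
  rw [coeffAt, LinearMap.comp_apply, LinearMap.applyₗ_apply_apply, gradedRep_single, mul_one,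
    permNorm_one, add_zero, if_pos rfl, Finsupp.lapply_apply, Finsupp.single_apply]

theorem coeffAt_repSum {d : ℕ} (π : Perm (Fin d)) (f : Perm (Fin d) → ℚ) :
    coeffAt π (repSum gradedRep f) = f π := by
  simp [repSum, coeffAt_gradedRep]

/-! ### The algebra `A(d)` as an algebra of operators -/

theorem mem_normStep_iff {d n : ℕ} {x : MonoidAlgebra ℚ (Perm (Fin d))} :
    x ∈ normStep d n ↔ ∀ σ, x.coeff σ ≠ 0 → permNorm σ ≤ n := by
  constructor
  · intro hx
    induction hx using Submodule.span_induction with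
    | mem x h =>
      obtain ⟨τ, hτ, rfl⟩ := h
      intro σ hσ
      simp only [MonoidAlgebra.coeff_single, Finsupp.single_apply] at hσ
      by_cases h : τ = σ
      · exact h ▸ hτ
      · simp [h] at hσ
    | zero => simp
    | add x y _ _ hx hy =>
      intro σ hσ
      by_cases h : x.coeff σ = 0
      · exact hy σ fun h' => hσ (by simp [h, h'])
      · exact hx σ h
    | smul r x _ hx =>
      intro σ hσ
      exact hx σ fun h => hσ (by simp [h])
  · intro h
    have h1 : x = ∑ σ, x.coeff σ • MonoidAlgebra.single σ (1 : ℚ) := by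
      apply MonoidAlgebra.coeff_injective
      ext σ
      simp
    rw [h1]
    refine Submodule.sum_mem _ fun σ _ => ?_
    by_cases h2 : x.coeff σ = 0
    · simp [h2]
    · exact Submodule.smul_mem _ _ (single_mem_normStep (h σ h2))

/-- The part of norm `n` of an element of the group algebra, as an operator. -/
def normPart (d n : ℕ) :
    MonoidAlgebra ℚ (Perm (Fin d)) →ₗ[ℚ] Module.End ℚ (Perm (Fin d) →₀ ℚ) where
  toFun x := repSum gradedRep fun σ => if permNorm σ = n then x.coeff σ else 0
  map_add' x y := by
    rw [repSum, repSum, repSum, ← Finset.sum_add_distrib]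
    refine Finset.sum_congr rfl fun σ _ => ?_
    split_ifs <;> simp [add_smul]
  map_smul' r x := by
    rw [repSum, repSum, RingHom.id_apply, Finset.smul_sum]
    refine Finset.sum_congr rfl fun σ _ => ?_
    split_ifs <;> simp [mul_smul]

theorem normPart_apply {d n : ℕ} (x : MonoidAlgebra ℚ (Perm (Fin d))) :
    normPart d n x = repSum gradedRep fun σ => if permNorm σ = n then x.coeff σ else 0 := rfl

theorem normPart_single {d n : ℕ} (σ : Perm (Fin d)) :
    normPart d n (MonoidAlgebra.single σ 1) = if permNorm σ = n then gradedRep σ else 0 := by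
  rw [normPart_apply, repSum, Finset.sum_eq_single σ]
  · split_ifs <;> simp
  · intro τ _ h
    split_ifs
    · simp [h.symm]
    · simp
  · simp

theorem coeffAt_normPart {d n : ℕ} (π : Perm (Fin d)) (x : MonoidAlgebra ℚ (Perm (Fin d))) :
    coeffAt π (normPart d n x) = if permNorm π = n then x.coeff π else 0 := by
  rw [normPart_apply, coeffAt_repSum]

/-- On filtered pieces, passing to the parts of top norm is multiplicative. -/
theorem normPart_mul {d i j : ℕ} {x y : MonoidAlgebra ℚ (Perm (Fin d))}
    (hx : x ∈ normStep d i) (hy : y ∈ normStep d j) :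
    normPart d (i + j) (x * y) = normPart d i x * normPart d j y := by
  induction hx using Submodule.span_induction with
  | zero => simp
  | add x x' _ _ h h' => rw [add_mul, map_add, map_add, add_mul, h, h']
  | smul r x _ h => rw [smul_mul_assoc, map_smul, map_smul, smul_mul_assoc, h]
  | mem x hx =>
    obtain ⟨σ, hσ, rfl⟩ := hx
    induction hy using Submodule.span_induction with
    | zero => simp
    | add x x' _ _ h h' => rw [mul_add, map_add, map_add, mul_add, h, h']
    | smul r x _ h => rw [mul_smul_comm, map_smul, map_smul, mul_smul_comm, h]
    | mem y hy =>
      obtain ⟨τ, hτ, rfl⟩ := hy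
      simp only [Set.mem_ofPred_eq] at hσ hτ
      have h1 := permNorm_mul_le σ τ
      simp only [MonoidAlgebra.single_mul_single, mul_one, normPart_single]
      by_cases h2 : permNorm (σ * τ) = i + j
      · rw [if_pos h2, if_pos (by omega), if_pos (by omega),
          (isGradedRep_gradedRep d).map_mul (by omega)]
      · rw [if_neg h2]
        split_ifs with h3 h4
        · rw [(isGradedRep_gradedRep d).map_mul_zero (by omega)]
        · rw [mul_zero]
        · rw [zero_mul]
        · rw [zero_mul]

theorem normPart_eq_zero_of_mem_lower {d n : ℕ} {x : ClassAlg d}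
    (hx : x ∈ (normFiltration d).lower n) :
    normPart d n (x : MonoidAlgebra ℚ (Perm (Fin d))) = 0 := by
  cases n with
  | zero =>
    rw [AlgFiltration.lower_zero, Submodule.mem_bot] at hx
    simp [hx]
  | succ n =>
    rw [AlgFiltration.lower_succ] at hx
    have h1 := mem_normStep_iff.mp hx
    rw [normPart_apply, repSum, Finset.sum_eq_zero]
    intro σ _
    split_ifs with h2
    · have h3 : (x : MonoidAlgebra ℚ (Perm (Fin d))).coeff σ = 0 := by
        by_contra h3
        have := h1 σ h3
        omega
      erw [h3]
      rw [zero_smul]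
    · rw [zero_smul]

/-- The part of top norm, on the graded pieces of the class-sum algebra. -/
def pieceRep (d n : ℕ) :
    (normFiltration d).Piece n →ₗ[ℚ] Module.End ℚ (Perm (Fin d) →₀ ℚ) :=
  Submodule.liftQ _ (normPart d n ∘ₗ
    (Subalgebra.center ℚ (MonoidAlgebra ℚ (Perm (Fin d)))).val.toLinearMap ∘ₗ
    ((normFiltration d).step n).subtype) fun _ hx => normPart_eq_zero_of_mem_lower hx

theorem pieceRep_toPiece {d n : ℕ} (x : (normFiltration d).step n) :
    pieceRep d n ((normFiltration d).toPiece n x)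
      = normPart d n ((x : ClassAlg d) : MonoidAlgebra ℚ (Perm (Fin d))) := rfl

/-- The representation of `A(d)` by operators on the graded group algebra. -/
def grRep (d : ℕ) : GradedClassAlg d →ₐ[ℚ] Module.End ℚ (Perm (Fin d) →₀ ℚ) :=
  DirectSum.toAlgebra ℚ (normFiltration d).Piece (pieceRep d)
    (by
      change normPart d 0 1 = 1
      rw [MonoidAlgebra.one_def, normPart_single, if_pos permNorm_one,
        (isGradedRep_gradedRep d).map_one])
    (by
      intro i j a b
      obtain ⟨x, rfl⟩ := (normFiltration d).toPiece_surjective i a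
      obtain ⟨y, rfl⟩ := (normFiltration d).toPiece_surjective j b
      exact normPart_mul x.2 y.2)

theorem grRep_of {d n : ℕ} (q : (normFiltration d).Piece n) :
    grRep d (DirectSum.of (normFiltration d).Piece n q) = pieceRep d n q :=
  DirectSum.toModule_lof ℚ n q

theorem grRep_symbol {d n : ℕ} (x : (normFiltration d).step n) :
    grRep d ((normFiltration d).symbol n x)
      = normPart d n ((x : ClassAlg d) : MonoidAlgebra ℚ (Perm (Fin d))) :=
  grRep_of _

theorem coeffAt_pieceRep_of_ne {d n : ℕ} {π : Perm (Fin d)} (h : permNorm π ≠ n)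
    (q : (normFiltration d).Piece n) : coeffAt π (pieceRep d n q) = 0 := by
  obtain ⟨x, rfl⟩ := (normFiltration d).toPiece_surjective n q
  rw [pieceRep_toPiece, coeffAt_normPart, if_neg h]

theorem coeffAt_grRep {d : ℕ} (π : Perm (Fin d)) (x : GradedClassAlg d) :
    coeffAt π (grRep d x) = coeffAt π (pieceRep d (permNorm π) (x (permNorm π))) := by
  induction x using DirectSum.induction_on with
  | zero => simp
  | of n q =>
    rw [grRep_of]
    by_cases h : permNorm π = n
    · subst h
      rw [DirectSum.of_eq_same]
    · rw [coeffAt_pieceRep_of_ne h, DirectSum.of_eq_of_ne _ _ _ h, map_zero, map_zero]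
  | add x y hx hy => rw [map_add, map_add, hx, hy, DirectSum.add_apply, map_add, map_add]

theorem grRep_injective (d : ℕ) : Function.Injective (grRep d) := by
  rw [injective_iff_map_eq_zero]
  intro x hx
  refine DFinsupp.ext fun n => ?_
  obtain ⟨y, hy⟩ := (normFiltration d).toPiece_surjective n (x n)
  rw [DFinsupp.zero_apply, ← hy, AlgFiltration.toPiece_eq_zero_iff]
  have h1 : ∀ σ : Perm (Fin d), permNorm σ = n →
      ((y : ClassAlg d) : MonoidAlgebra ℚ (Perm (Fin d))).coeff σ = 0 := by
    rintro σ rfl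
    have h2 := coeffAt_grRep σ x
    rw [hx, map_zero, ← hy, pieceRep_toPiece, coeffAt_normPart, if_pos rfl] at h2
    exact h2.symm
  have h3 := mem_normStep_iff.mp y.2
  cases n with
  | zero =>
    rw [AlgFiltration.lower_zero, Submodule.mem_bot]
    apply Subtype.ext
    apply MonoidAlgebra.coeff_injective
    ext σ
    by_contra h4
    exact h4 (h1 σ (Nat.le_zero.mp (h3 σ h4)))
  | succ n =>
    rw [AlgFiltration.lower_succ]
    refine mem_normStep_iff.mpr fun σ hσ => ?_
    have h4 := h3 σ hσ
    have h5 : permNorm σ ≠ n + 1 := fun h => hσ (h1 σ h)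
    omega

theorem grRep_gammaElt {d k : ℕ} (hk : 2 ≤ k) :
    grRep d (gammaElt d k) = classRep gradedRep {k} := by
  rw [gammaElt, grRep_symbol]
  change normPart d (k - 1) (cycleSum d k) = _
  rw [cycleSum, map_sum, classRep]
  refine Finset.sum_congr rfl fun σ hσ => ?_
  have := permNorm_add_one_of_cycleType (Finset.mem_filter.mp hσ).2
  rw [normPart_single, if_pos (by omega)]

theorem isClassFn_coeff_of_mem_center {d : ℕ} {x : MonoidAlgebra ℚ (Perm (Fin d))}
    (hx : x ∈ Subalgebra.center ℚ (MonoidAlgebra ℚ (Perm (Fin d)))) :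
    IsClassFn fun σ => x.coeff σ := by
  refine IsClassFn.of_conj fun σ τ => ?_
  have h1 := Subalgebra.mem_center_iff.mp hx (MonoidAlgebra.single τ 1)
  have h2 := congrArg (fun z : MonoidAlgebra ℚ (Perm (Fin d)) => z.coeff (τ * σ)) h1
  have h3 : τ * σ = (τ * σ * τ⁻¹) * τ := by group
  simp only [MonoidAlgebra.coeff_single_mul_apply, inv_mul_cancel_left, one_mul] at h2
  rw [h2, MonoidAlgebra.coeff_mul_single_apply, mul_one]

/-- The `γ_k` with `k ≤ d / 2 + 1` generate: `grRep` is injective, and the image of the subalgebra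
they generate contains all class sums. -/
theorem adjoin_gammaElt (d : ℕ) :
    Algebra.adjoin ℚ (gammaElt d '' Set.Icc 2 (d / 2 + 1))
      = (⊤ : Subalgebra ℚ (GradedClassAlg d)) := by
  set B := Algebra.adjoin ℚ (gammaElt d '' Set.Icc 2 (d / 2 + 1)) with hB
  have h1 : ∀ π : Perm (Fin d), classRep gradedRep π.cycleType ∈ B.map (grRep d) := by
    refine classRep_mem (isGradedRep_gradedRep d) fun k hk => ?_
    rw [← grRep_gammaElt hk.1]
    exact Subalgebra.mem_map.mpr ⟨_, Algebra.subset_adjoin ⟨k, hk, rfl⟩, rfl⟩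
  refine eq_top_iff.mpr fun x _ => ?_
  induction x using DirectSum.induction_on with
  | zero => exact B.zero_mem
  | add x y hx hy => exact B.add_mem (hx trivial) (hy trivial)
  | of n q =>
    obtain ⟨y, rfl⟩ := (normFiltration d).toPiece_surjective n q
    have h2 : grRep d (DirectSum.of _ n ((normFiltration d).toPiece n y)) ∈ B.map (grRep d) := by
      rw [grRep_of, pieceRep_toPiece, normPart_apply]
      refine repSum_mem (B := Subalgebra.toSubmodule (B.map (grRep d))) (fun σ τ h => ?_)
        fun π _ => h1 π
      have h3 := isClassFn_coeff_of_mem_center (y : ClassAlg d).2 σ τ h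
      simp only [permNorm_eq_of_cycleType_eq h]
      split_ifs
      · exact h3
      · rfl
    obtain ⟨z, hz, hzx⟩ := Subalgebra.mem_map.mp h2
    exact grRep_injective d hzx ▸ hz

end

noncomputable section
open Equiv

/-! ### Minimality of the generators -/

/-- In the stable range every partition of `n` is, up to shifting its parts by one, the cycle type
of a permutation of norm `n`. -/
theorem exists_perm_of_partition {d n : ℕ} (h : 2 * n ≤ d) (p : n.Partition) :
    ∃ σ : Perm (Fin d), σ.cycleType = p.parts.map (· + 1) ∧ permNorm σ = n := by
  have h1 : (p.parts.map (· + 1)).sum = n + p.parts.card := by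
    rw [Multiset.sum_map_add, Multiset.map_id', p.parts_sum]
    simp
  have h2 : p.parts.card ≤ n := by
    have := Multiset.card_nsmul_le_sum (s := p.parts) (a := 1) fun x hx => p.parts_pos hx
    rwa [p.parts_sum, smul_eq_mul, mul_one] at this
  obtain ⟨σ, hσ⟩ := (Perm.exists_with_cycleType_iff (Fin d) (m := p.parts.map (· + 1))).mpr (by
    refine ⟨by rw [h1, Fintype.card_fin]; omega, fun a ha => ?_⟩
    obtain ⟨b, hb, rfl⟩ := Multiset.mem_map.mp ha
    have := p.parts_pos hb
    omega)
  refine ⟨σ, hσ, ?_⟩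
  have h3 := permNorm_add_card_cycleType σ
  rw [← Perm.sum_cycleType, hσ, h1, Multiset.card_map] at h3
  omega

/-- A monomial in the `γ_k` is homogeneous. -/
theorem exists_prod_gammaElt_eq_of (d : ℕ) (w : Multiset ℕ) :
    ∃ q, (w.map (gammaElt d)).prod
      = DirectSum.of (normFiltration d).Piece (w.map (· - 1)).sum q := by
  induction w using Multiset.induction with
  | empty => exact ⟨GradedMonoid.GOne.one, by rw [Multiset.map_zero, Multiset.prod_zero]; rfl⟩
  | cons k w ih =>
    obtain ⟨q, hq⟩ := ih
    rw [Multiset.map_cons (fun j => j - 1), Multiset.sum_cons, Multiset.map_cons (gammaElt d),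
      Multiset.prod_cons, hq, gammaElt, AlgFiltration.symbol, DirectSum.of_mul_of]
    exact ⟨_, rfl⟩

theorem exists_multiset_of_mem_closure_gammaElt {d : ℕ} {s : Set ℕ} {x : GradedClassAlg d}
    (hx : x ∈ Submonoid.closure (gammaElt d '' s)) :
    ∃ w : Multiset ℕ, (∀ k ∈ w, k ∈ s) ∧ (w.map (gammaElt d)).prod = x := by
  induction hx using Submonoid.closure_induction with
  | mem x hx =>
    obtain ⟨k, hk, rfl⟩ := hx
    exact ⟨{k}, by simpa using hk, by simp⟩
  | one => exact ⟨0, by simp, by simp⟩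
  | mul x y _ _ hx hy =>
    obtain ⟨w, hw, rfl⟩ := hx
    obtain ⟨w', hw', rfl⟩ := hy
    refine ⟨w + w', fun k hk => ?_, by simp⟩
    exact (Multiset.mem_add.mp hk).elim (hw k) (hw' k)

/-- In degree `n ≤ d / 2` the dimension of `A(d)` is the number of partitions of `n`, whereas there
are fewer monomials of degree `n` in the `γ_j` with `j ≠ n + 1`. -/
theorem adjoin_gammaElt_ne_top {d n : ℕ} (hn0 : n ≠ 0) (hn : 2 * n ≤ d) {s : Set ℕ}
    (hs : ∀ k ∈ s, 2 ≤ k) (hns : n + 1 ∉ s) :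
    Algebra.adjoin ℚ (gammaElt d '' s) ≠ (⊤ : Subalgebra ℚ (GradedClassAlg d)) := by
  intro htop
  choose σ hσ hσn using exists_perm_of_partition hn
  -- The coefficients at one permutation of norm `n` for each partition of `n`.
  let θ : GradedClassAlg d →ₗ[ℚ] (n.Partition → ℚ) :=
    LinearMap.pi fun p => coeffAt (σ p) ∘ₗ (grRep d).toLinearMap
  have hθ : ∀ x p, θ x p = coeffAt (σ p) (grRep d x) := fun _ _ => rfl
  have hinj : Function.Injective fun p : n.Partition => (σ p).cycleType := by
    intro p q h
    simp only [hσ] at h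
    exact Nat.Partition.ext (Multiset.map_injective (add_left_injective 1) h)
  have hsurj : LinearMap.range θ = ⊤ := by
    rw [eq_top_iff, ← (Pi.basisFun ℚ n.Partition).span_eq, Submodule.span_le]
    rintro _ ⟨p, rfl⟩
    have h1 : classRep gradedRep (σ p).cycleType ∈ (grRep d).range :=
      classRep_mem (isGradedRep_gradedRep d)
        (fun k hk => AlgHom.mem_range _ |>.mpr ⟨_, grRep_gammaElt hk.1⟩) (σ p)
    obtain ⟨x, hx⟩ := h1
    refine ⟨x, funext fun q => ?_⟩
    have hx' : grRep d x = classRep gradedRep (σ p).cycleType := hx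
    rw [hθ, hx', ← repSum_indicator, coeffAt_repSum, Pi.basisFun_apply, Pi.single_apply]
    simp only [hinj.eq_iff (a := q) (b := p)]
  -- The monomials of degree `n`, except `γ_(n + 1)` itself.
  let m : n.Partition → (n.Partition → ℚ) := fun p =>
    θ (p.parts.map fun j => gammaElt d (j + 1)).prod
  let F : Finset (n.Partition → ℚ) := (Finset.univ.erase (Nat.Partition.indiscrete n)).image m
  have hspan : Submodule.span ℚ (F : Set (n.Partition → ℚ)) = ⊤ := by
    rw [eq_top_iff, ← hsurj, LinearMap.range_eq_map, ← Algebra.top_toSubmodule, ← htop,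
      Algebra.adjoin_eq_span, Submodule.map_span, Submodule.span_le]
    rintro _ ⟨x, hx, rfl⟩
    obtain ⟨w, hw, rfl⟩ := exists_multiset_of_mem_closure_gammaElt hx
    by_cases hdeg : (w.map (· - 1)).sum = n
    · refine Submodule.subset_span (Finset.mem_coe.mpr (Finset.mem_image.mpr
        ⟨⟨w.map (· - 1), fun {i} hi => ?_, hdeg⟩, ?_, ?_⟩))
      · obtain ⟨k, hk, rfl⟩ := Multiset.mem_map.mp hi
        have := hs k (hw k hk)
        omega
      · refine Finset.mem_erase.mpr ⟨fun h => ?_, Finset.mem_univ _⟩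
        have h1 : w.map (· - 1) = _ := congrArg Nat.Partition.parts h
        rw [Nat.Partition.indiscrete_parts hn0] at h1
        obtain ⟨k, hk, hkn⟩ := Multiset.mem_map.mp
          (by rw [h1]; exact Multiset.mem_singleton_self n : n ∈ w.map (· - 1))
        have := hs k (hw k hk)
        exact hns ((by omega : k = n + 1) ▸ hw k hk)
      · change θ ((w.map (· - 1)).map fun j => gammaElt d (j + 1)).prod = _
        rw [Multiset.map_map]
        refine congrArg (fun w => θ (Multiset.prod w)) (Multiset.map_congr rfl fun k hk => ?_)
        have := hs k (hw k hk)
        rw [Function.comp_apply, Nat.sub_add_cancel (by omega)]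
    · have h0 : θ (w.map (gammaElt d)).prod = 0 := by
        obtain ⟨q, hq⟩ := exists_prod_gammaElt_eq_of d w
        refine funext fun p => ?_
        rw [hθ, hq, grRep_of, coeffAt_pieceRep_of_ne, Pi.zero_apply]
        rw [hσn]
        exact fun h => hdeg h.symm
      rw [h0]
      exact Submodule.zero_mem _
  have h1 := finrank_span_finset_le_card (R := ℚ) F
  rw [Set.finrank, hspan, finrank_top, Module.finrank_fintype_fun_eq_card] at h1
  have h2 : F.card ≤ Fintype.card n.Partition - 1 := by
    refine Finset.card_image_le.trans_eq ?_
    rw [Finset.card_erase_of_mem (Finset.mem_univ _), Finset.card_univ]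
  have h3 : 0 < Fintype.card n.Partition := Fintype.card_pos
  omega

end

theorem mainTheorem1 (d : ℕ) :
    Algebra.adjoin ℚ (gammaElt d '' Set.Icc 2 (d / 2 + 1)) = (⊤ : Subalgebra ℚ (GradedClassAlg d)) ∧
    ∀ s : Set ℕ, s ⊂ Set.Icc 2 (d / 2 + 1) →
      Algebra.adjoin ℚ (gammaElt d '' s) ≠ (⊤ : Subalgebra ℚ (GradedClassAlg d)) := by
  refine ⟨adjoin_gammaElt d, fun s hs => ?_⟩
  obtain ⟨k, ⟨hk2, hkd⟩, hks⟩ := Set.exists_of_ssubset hs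
  obtain ⟨n, rfl⟩ : ∃ n, k = n + 1 := ⟨k - 1, by omega⟩
  exact adjoin_gammaElt_ne_top (by omega) (by omega) (fun j hj => (hs.1 hj).1) hks
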